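/- Consider the intuitionistic predicate language with countably many individual variables, countably many predicate letters of every arity $n\ge 0$, the constant $\bot$, the connectives $\wedge,\vee,\to$ and the quantifiers $\forall,\exists$ (no equality, no function symbols). Let $\mathbf{QInt}$ be the set of formulas true in every intuitionistic predicate Kripke model with expanding domains. A superintuitionistic predicate logic is a set of formulas that contains $\mathbf{QInt}$ and is closed under Modus Ponens, (capture-avoiding) Substitution of formulas for predicate letters, and Generalization; for such a logic $L$ and a set of formulas $\Gamma$, $L+\Gamma$ denotes the smallest superintuitionistic predicate logic containing $L\cup\Gamma$. Put $$\mathbf{QLC}=\mathbf{QInt}+\{(p\to q)\vee(q\to p)\},\qquad \mathbf{QLC.cd}=\mathbf{QLC}+\{\forall x\,(P(x)\vee p)\to \forall x\,P(x)\vee p\},$$ where $p,q$ are distinct nullary predicate letters and $P$ is a unary predicate letter. Then $\mathbf{QLC.cd}$ is $\Sigma^0_1$-complete in the language with two individual variables, a single binary predicate letter and infinitely many unary predicate letters. That is, fix two individual variables and one binary predicate letter; the set of (Gödel numbers of) formulas of $\mathbf{QLC.cd}$ that contain no individual variables, free or bound, other than these two (each may be quantified repeatedly), and no predicate letters other than the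 fixed binary letter and the unary letters, is recursively enumerable, and every recursively enumerable set of natural numbers is many-one reducible to it. -/

import Mathlib

namespace IntPred

/-- Formulas of the intuitionistic predicate language. The individual variables are
`x₀, x₁, x₂, …`, represented by their indices. For every arity `n` there are countably many
`n`-ary predicate letters, indexed by natural numbers; `atom i xs` is the `i`-th predicate letter
of arity `xs.length` applied to the list of variables `xs` (so letters of different arities with
the same index are different letters). -/
inductive Formula : Type
  | bot : Formula
  | atom (i : ℕ) (xs : List ℕ) : Formula
  | and (φ ψ : Formula) : Formula
  | or (φ ψ : Formula) : Formula
  | imp (φ ψ : Formula) : Formula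
  | all (x : ℕ) (φ : Formula) : Formula
  | ex (x : ℕ) (φ : Formula) : Formula

/-- An intuitionistic predicate Kripke model with expanding domains: a non-empty partially ordered
set `W` of worlds, a set `U` of individuals, a non-empty local domain `D w ⊆ U` for each world,
and a hereditary interpretation, in which `I w i` collects the tuples (lists) over `D w` satisfying
at `w` the predicate letters with index `i`; its members of length `n` interpret the
`i`-th `n`-ary letter. -/
structure KripkeModel where
  W : Type
  [order : PartialOrder W]
  [nonemptyW : Nonempty W]
  U : Type
  D : W → Set U
  D_nonempty : ∀ w, (D w).Nonempty
  D_mono : ∀ {w v : W}, w ≤ v → D w ⊆ D v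
  I : W → ℕ → Set (List U)
  I_dom : ∀ {w : W} {i : ℕ} {l : List U}, l ∈ I w i → ∀ d ∈ l, d ∈ D w
  I_mono : ∀ {w v : W} (i : ℕ), w ≤ v → I w i ⊆ I v i

attribute [instance] KripkeModel.order KripkeModel.nonemptyW

/-- `M.Forces φ w g`: the formula `φ` is true at the world `w` of `M` under the assignment `g`. -/
def KripkeModel.Forces (M : KripkeModel) : Formula → M.W → (ℕ → M.U) → Prop
  | .bot, _, _ => False
  | .atom i xs, w, g => xs.map g ∈ M.I w i
  | .and φ ψ, w, g => M.Forces φ w g ∧ M.Forces ψ w g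
  | .or φ ψ, w, g => M.Forces φ w g ∨ M.Forces ψ w g
  | .imp φ ψ, w, g => ∀ v, w ≤ v → M.Forces φ v g → M.Forces ψ v g
  | .all x φ, w, g => ∀ v, w ≤ v → ∀ d ∈ M.D v, M.Forces φ v (Function.update g x d)
  | .ex x φ, w, g => ∃ d ∈ M.D w, M.Forces φ w (Function.update g x d)

namespace Formula

/-- The set of free variables. -/
def fv : Formula → Finset ℕ
  | bot => ∅
  | atom _ xs => xs.toFinset
  | and φ ψ => φ.fv ∪ ψ.fv
  | or φ ψ => φ.fv ∪ ψ.fv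
  | imp φ ψ => φ.fv ∪ ψ.fv
  | all x φ => φ.fv.erase x
  | ex x φ => φ.fv.erase x

/-- A variable outside `S`: the variable `x` itself if possible. -/
def freshVar (x : ℕ) (S : Finset ℕ) : ℕ :=
  if x ∈ S then S.sup id + 1 else x

/-- Capture-avoiding simultaneous substitution of the variable `f x` for each free variable `x`;
a bound variable is renamed when it would capture. -/
def rename : (ℕ → ℕ) → Formula → Formula
  | _, bot => bot
  | f, atom i xs => atom i (xs.map f)
  | f, and φ ψ => and (φ.rename f) (ψ.rename f)
  | f, or φ ψ => or (φ.rename f) (ψ.rename f)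
  | f, imp φ ψ => imp (φ.rename f) (ψ.rename f)
  | f, all x φ =>
      let z := freshVar x ((φ.fv.erase x).image f)
      all z (φ.rename (Function.update f x z))
  | f, ex x φ =>
      let z := freshVar x ((φ.fv.erase x).image f)
      ex z (φ.rename (Function.update f x z))

/-- The map on variables sending the variables `zs` to the corresponding members of `ys`, and
fixing all other variables. -/
def assign (zs ys : List ℕ) (k : ℕ) : ℕ :=
  if k ∈ zs then ys.getD (zs.idxOf k) k else k

/-- `substAux i zs ψ f φ`: in `φ`, replace the free variables by means of `f`, and the `i`-th
predicate letter `P` of arity `zs.length` by the formula `ψ`, where `zs` is the list of the argument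
variables of `ψ` (its other free variables are parameters), so that `P(y₁,…,yₙ)` becomes
`ψ[y₁/z₁,…,yₙ/zₙ]`. Bound variables are renamed when they would capture. -/
def substAux (i : ℕ) (zs : List ℕ) (ψ : Formula) : (ℕ → ℕ) → Formula → Formula
  | _, bot => bot
  | f, atom j xs =>
      if j = i ∧ xs.length = zs.length then ψ.rename (assign zs (xs.map f))
      else atom j (xs.map f)
  | f, and φ χ => and (substAux i zs ψ f φ) (substAux i zs ψ f χ)
  | f, or φ χ => or (substAux i zs ψ f φ) (substAux i zs ψ f χ)
  | f, imp φ χ => imp (substAux i zs ψ f φ) (substAux i zs ψ f χ)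
  | f, all x φ =>
      let z := freshVar x ((φ.fv.erase x).image f ∪ (ψ.fv \ zs.toFinset))
      all z (substAux i zs ψ (Function.update f x z) φ)
  | f, ex x φ =>
      let z := freshVar x ((φ.fv.erase x).image f ∪ (ψ.fv \ zs.toFinset))
      ex z (substAux i zs ψ (Function.update f x z) φ)

/-- The result of substituting `ψ(z₁,…,zₙ)` for `P(z₁,…,zₙ)` in `φ`, where `P` is the `i`-th `n`-ary
predicate letter and `zs = [z₁,…,zₙ]`. -/
def subst (i : ℕ) (zs : List ℕ) (ψ φ : Formula) : Formula :=
  substAux i zs ψ id φ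

/-- Gödel numbering of formulas. -/
def code : Formula → ℕ
  | bot => 0
  | atom i xs => 6 * Nat.pair i (Encodable.encode xs) + 1
  | and φ ψ => 6 * Nat.pair φ.code ψ.code + 2
  | or φ ψ => 6 * Nat.pair φ.code ψ.code + 3
  | imp φ ψ => 6 * Nat.pair φ.code ψ.code + 4
  | all x φ => 6 * Nat.pair x φ.code + 5
  | ex x φ => 6 * Nat.pair x φ.code + 6

theorem code_injective : Function.Injective code := by
  have key : ∀ {a b c d k : ℕ}, 6 * Nat.pair a b + k = 6 * Nat.pair c d + k → a = c ∧ b = d := by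
    intro a b c d k h
    exact Nat.pair_eq_pair.1 (by omega)
  intro φ
  induction φ with
  | bot => intro ψ h; cases ψ <;> simp only [code] at h <;> first | rfl | omega
  | atom i xs =>
    intro ψ h
    cases ψ <;> simp only [code] at h <;> try omega
    obtain ⟨h1, h2⟩ := key h
    rw [h1, Encodable.encode_injective h2]
  | and φ₁ φ₂ ih₁ ih₂ =>
    intro ψ h
    cases ψ <;> simp only [code] at h <;> try omega
    obtain ⟨h1, h2⟩ := key h
    rw [ih₁ h1, ih₂ h2]
  | or φ₁ φ₂ ih₁ ih₂ =>
    intro ψ h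
    cases ψ <;> simp only [code] at h <;> try omega
    obtain ⟨h1, h2⟩ := key h
    rw [ih₁ h1, ih₂ h2]
  | imp φ₁ φ₂ ih₁ ih₂ =>
    intro ψ h
    cases ψ <;> simp only [code] at h <;> try omega
    obtain ⟨h1, h2⟩ := key h
    rw [ih₁ h1, ih₂ h2]
  | all x φ ih =>
    intro ψ h
    cases ψ <;> simp only [code] at h <;> try omega
    obtain ⟨h1, h2⟩ := key h
    rw [h1, ih h2]
  | ex x φ ih =>
    intro ψ h
    cases ψ <;> simp only [code] at h <;> try omega
    obtain ⟨h1, h2⟩ := key h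
    rw [h1, ih h2]

/-- The formula is built with (at most) the two individual variables `x₀, x₁`, the binary
predicate letter with index `0`, and the unary predicate letters. -/
def InFragment : Formula → Prop
  | bot => True
  | atom i xs => ((xs.length = 2 ∧ i = 0) ∨ xs.length = 1) ∧ ∀ x ∈ xs, x < 2
  | and φ ψ => φ.InFragment ∧ ψ.InFragment
  | or φ ψ => φ.InFragment ∧ ψ.InFragment
  | imp φ ψ => φ.InFragment ∧ ψ.InFragment
  | all x φ => x < 2 ∧ φ.InFragment
  | ex x φ => x < 2 ∧ φ.InFragment

end Formula

/-- `φ` is true in `M`: at every world, under every assignment sending the free variables of `φ`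
to the domain of that world. -/
def KripkeModel.Valid (M : KripkeModel) (φ : Formula) : Prop :=
  ∀ (w : M.W) (g : ℕ → M.U), (∀ x ∈ φ.fv, g x ∈ M.D w) → M.Forces φ w g

/-- Intuitionistic predicate logic. -/
def QInt : Set Formula :=
  {φ | ∀ M : KripkeModel, M.Valid φ}

/-- Superintuitionistic predicate logics. -/
structure IsSuperintuitionisticLogic (L : Set Formula) : Prop where
  qInt_subset : QInt ⊆ L
  modusPonens : ∀ {φ ψ : Formula}, φ ∈ L → Formula.imp φ ψ ∈ L → ψ ∈ L
  substitution : ∀ {φ : Formula} (i : ℕ) (zs : List ℕ) (ψ : Formula), zs.Nodup → φ ∈ L →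
    Formula.subst i zs ψ φ ∈ L
  generalization : ∀ {φ : Formula} (x : ℕ), φ ∈ L → Formula.all x φ ∈ L

/-- `L + Γ`: the smallest superintuitionistic predicate logic containing `L ∪ Γ`. -/
def extend (L Γ : Set Formula) : Set Formula :=
  {φ | ∀ L' : Set Formula, IsSuperintuitionisticLogic L' → L ∪ Γ ⊆ L' → φ ∈ L'}

/-- The linearity axiom `(p → q) ∨ (q → p)`, with `p`, `q` distinct nullary letters. -/
def linAxiom : Formula :=
  .or (.imp (.atom 0 []) (.atom 1 [])) (.imp (.atom 1 []) (.atom 0 []))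

/-- The constant domain axiom `∀ x (P(x) ∨ p) → ∀ x P(x) ∨ p`, with `P` a unary and `p` a nullary
letter. -/
def cdAxiom : Formula :=
  .imp (.all 0 (.or (.atom 0 [0]) (.atom 0 []))) (.or (.all 0 (.atom 0 [0])) (.atom 0 []))

/-- `QLC = QInt + (p → q) ∨ (q → p)`. -/
def QLC : Set Formula := extend QInt {linAxiom}

/-- `QLC.cd = QLC + cd`. -/
def QLCcd : Set Formula := extend QLC {cdAxiom}

/-- A set of natural numbers is `Σ⁰₁`-complete: it is recursively enumerable, and every recursively
enumerable set of natural numbers is many-one reducible to it. -/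
def IsSigma01Complete (A : Set ℕ) : Prop :=
  REPred (fun n => n ∈ A) ∧ ∀ B : Set ℕ, REPred (fun n => n ∈ B) → (fun n => n ∈ B) ≤₀ (fun n => n ∈ A)

end IntPred

/-!
The logic `QLC.cd` is sound for Kripke models with linearly ordered worlds and constant domains
(`valid_of_mem_QLCcd`). Both halves of the theorem compare it with such models.

*Enumerability.* Suppose that `φ` is not in `QLC.cd`. Enumerate all pairs of instances of formulas
and decide, one pair `a`, `b` after the other, whether `a → b` is accepted or rejected, keeping the
accepted formulas from entailing the disjunction of the rejected ones. With a rejected comparison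
that involves a quantified formula a witnessing instance with a fresh parameter is rejected as well,
which the constant domain axiom permits. Since linearity makes the comparisons total, the result is a
countable chain of truth values in which quantifiers are approximated by instances: a *Henkin
chain* (`exists_isHenkinChain`). Conversely, the cuts of a Henkin chain at which the quantifiers are
infinitary meets and joins are the worlds of a linear model with constant domain, and a
Rasiowa–Sikorski argument provides sufficiently many of them (`IsHenkinChain.exists_cut`), so that
truth at a cut is membership in it (`IsHenkinChain.forces_model_iff`). Hence `φ ∉ QLC.cd` if and only
if a Henkin chain refutes `φ` (`notMem_QLCcd_iff`). As the fresh parameter is a fixed function of the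
two formulas compared, being a Henkin chain is a condition given by a primitive recursive set of
propositional clauses on the truth values of the comparisons, and by compactness of Cantor space the
unsatisfiability of such a set is recursively enumerable (`rePred_unsatisfiable`).

*Hardness.* The truth value of `A(x)`, for a unary letter `A`, serves as the value of an attribute
of `x`, and `(A(x) → B(y)) ∧ (B(y) → A(x))` says that two values are equal. Weakening the conclusion
of each rule by the goal as a disjunct makes a set of two-variable Horn-like rules about attributes
mean the same intuitionistically as classically: if the rules imply the goal in all classical
structures, the translated implication is in `QInt`, because a world refuting it is itself a
classical structure with sets of worlds as values (`reductionFormula_mem_QInt`); and a classical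
counterexample, with its values linearly ordered, is a linear Kripke model with constant domain
refuting it (`reductionFormula_notMem_QLCcd`). Such rules can simulate the abstract machine for
`Turing.ToPartrec.Code`, the attributes being the components of its configurations. If the
computation halts, every structure satisfying the rules contains its final configuration
(`exists_ret_halt_of_init`); if it does not, marking the configurations with non-halting computations gives a
counterexample (`cfgModel`). The resulting formulas (`haltFormula`) use two variables and unary
letters only, and are computed primitive recursively from the input.
-/

namespace IntPred

/-! ### Forcing with an arbitrary interpretation of the predicate letters -/

/-- Forcing over the frame of `M`, with `A` in place of the interpretation of the predicate
letters. No heredity and no domain condition is imposed on `A`, so that the truth sets of formulas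
can be plugged in for predicate letters. -/
def KripkeModel.ForcesA (M : KripkeModel) (A : M.W → ℕ → List M.U → Prop) :
    Formula → M.W → (ℕ → M.U) → Prop
  | .bot, _, _ => False
  | .atom i xs, w, g => A w i (xs.map g)
  | .and φ ψ, w, g => M.ForcesA A φ w g ∧ M.ForcesA A ψ w g
  | .or φ ψ, w, g => M.ForcesA A φ w g ∨ M.ForcesA A ψ w g
  | .imp φ ψ, w, g => ∀ v, w ≤ v → M.ForcesA A φ v g → M.ForcesA A ψ v g
  | .all x φ, w, g => ∀ v, w ≤ v → ∀ d ∈ M.D v, M.ForcesA A φ v (Function.update g x d)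
  | .ex x φ, w, g => ∃ d ∈ M.D w, M.ForcesA A φ w (Function.update g x d)

/-- The interpretation of the predicate letters in `M`, as a family of predicates. -/
def KripkeModel.interp (M : KripkeModel) : M.W → ℕ → List M.U → Prop := fun w i l => l ∈ M.I w i

section
variable (M : KripkeModel) (A : M.W → ℕ → List M.U → Prop)

theorem forces_iff_forcesA (φ : Formula) (w : M.W) (g : ℕ → M.U) :
    M.Forces φ w g ↔ M.ForcesA M.interp φ w g := by
  induction φ generalizing w g <;>
    simp_all [KripkeModel.Forces, KripkeModel.ForcesA, KripkeModel.interp]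

theorem forcesA_congr (φ : Formula) {w : M.W} {g h : ℕ → M.U} (H : ∀ x ∈ φ.fv, g x = h x) :
    M.ForcesA A φ w g ↔ M.ForcesA A φ w h := by
  induction φ generalizing w g h with
  | bot => rfl
  | atom i xs =>
    have : xs.map g = xs.map h := List.map_congr_left fun x hx => H x (by simpa [Formula.fv] using hx)
    simp [KripkeModel.ForcesA, this]
  | and φ ψ h1 h2 =>
    simp only [Formula.fv, Finset.mem_union] at H
    simp only [KripkeModel.ForcesA]
    rw [h1 fun x hx => H x (.inl hx), h2 fun x hx => H x (.inr hx)]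
  | or φ ψ h1 h2 =>
    simp only [Formula.fv, Finset.mem_union] at H
    simp only [KripkeModel.ForcesA]
    rw [h1 fun x hx => H x (.inl hx), h2 fun x hx => H x (.inr hx)]
  | imp φ ψ h1 h2 =>
    simp only [Formula.fv, Finset.mem_union] at H
    simp only [KripkeModel.ForcesA]
    refine forall₂_congr fun v _ => ?_
    rw [h1 fun x hx => H x (.inl hx), h2 fun x hx => H x (.inr hx)]
  | all x φ ih =>
    simp only [KripkeModel.ForcesA]
    refine forall₂_congr fun v _ => forall₂_congr fun d _ => ih fun y hy => ?_
    by_cases hyx : y = x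
    · simp [hyx]
    · simpa [hyx] using H y (by simp [Formula.fv, hyx, hy])
  | ex x φ ih =>
    simp only [KripkeModel.ForcesA]
    refine exists_congr fun d => and_congr_right fun _ => ih fun y hy => ?_
    by_cases hyx : y = x
    · simp [hyx]
    · simpa [hyx] using H y (by simp [Formula.fv, hyx, hy])

theorem forcesA_mono (hA : ∀ {w v : M.W}, w ≤ v → ∀ i l, A w i l → A v i l) (φ : Formula)
    {w v : M.W} (hwv : w ≤ v) {g : ℕ → M.U} (h : M.ForcesA A φ w g) : M.ForcesA A φ v g := by
  induction φ generalizing w v g with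
  | bot => exact h
  | atom i xs => exact hA hwv _ _ h
  | and φ ψ h1 h2 => exact ⟨h1 hwv h.1, h2 hwv h.2⟩
  | or φ ψ h1 h2 => exact h.imp (h1 hwv) (h2 hwv)
  | imp φ ψ h1 h2 => exact fun u hu => h u (hwv.trans hu)
  | all x φ ih => exact fun u hu => h u (hwv.trans hu)
  | ex x φ ih =>
    obtain ⟨d, hd, h⟩ := h
    exact ⟨d, M.D_mono hwv hd, ih hwv h⟩

end

theorem forces_congr (M : KripkeModel) (φ : Formula) {w : M.W} {g h : ℕ → M.U}
    (H : ∀ x ∈ φ.fv, g x = h x) : M.Forces φ w g ↔ M.Forces φ w h := by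
  simp only [forces_iff_forcesA, forcesA_congr M _ φ H]

theorem forces_mono (M : KripkeModel) (φ : Formula) {w v : M.W} (hwv : w ≤ v) {g : ℕ → M.U}
    (h : M.Forces φ w g) : M.Forces φ v g := by
  rw [forces_iff_forcesA] at h ⊢
  exact forcesA_mono M M.interp (fun h i _ hl => M.I_mono i h hl) φ hwv h

/-! ### Semantics of renaming and substitution -/

theorem Formula.freshVar_notMem (x : ℕ) (S : Finset ℕ) : Formula.freshVar x S ∉ S := by
  unfold Formula.freshVar
  split_ifs with h
  · intro h'
    have : S.sup id + 1 ≤ S.sup id := Finset.le_sup (f := id) h'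
    omega
  · exact h

theorem forcesA_rename (M : KripkeModel) (A : M.W → ℕ → List M.U → Prop) (φ : Formula)
    (f : ℕ → ℕ) (w : M.W) (g : ℕ → M.U) :
    M.ForcesA A (φ.rename f) w g ↔ M.ForcesA A φ w (g ∘ f) := by
  have key : ∀ (x : ℕ) (φ : Formula) (f : ℕ → ℕ) (g : ℕ → M.U) (d : M.U) (w : M.W),
      M.ForcesA A φ w (Function.update g (Formula.freshVar x ((φ.fv.erase x).image f)) d ∘
        Function.update f x (Formula.freshVar x ((φ.fv.erase x).image f))) ↔
      M.ForcesA A φ w (Function.update (g ∘ f) x d) := by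
    intro x φ f g d w
    refine forcesA_congr M A φ fun y hy => ?_
    by_cases hyx : y = x
    · simp [hyx]
    · have : f y ≠ Formula.freshVar x ((φ.fv.erase x).image f) := fun h =>
        Formula.freshVar_notMem x ((φ.fv.erase x).image f)
          (h ▸ Finset.mem_image_of_mem f (by simp [hyx, hy]))
      simp [hyx, this]
  induction φ generalizing f w g with
  | bot => rfl
  | atom i xs => simp [Formula.rename, KripkeModel.ForcesA]
  | and φ ψ h1 h2 => simp only [Formula.rename, KripkeModel.ForcesA, h1, h2]
  | or φ ψ h1 h2 => simp only [Formula.rename, KripkeModel.ForcesA, h1, h2]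
  | imp φ ψ h1 h2 => simp only [Formula.rename, KripkeModel.ForcesA, h1, h2]
  | all x φ ih => simp only [Formula.rename, KripkeModel.ForcesA, ih, key]
  | ex x φ ih => simp only [Formula.rename, KripkeModel.ForcesA, ih, key]

theorem forces_rename (M : KripkeModel) (φ : Formula) (f : ℕ → ℕ) (w : M.W) (g : ℕ → M.U) :
    M.Forces (φ.rename f) w g ↔ M.Forces φ w (g ∘ f) := by
  simp only [forces_iff_forcesA, forcesA_rename]

/-- The interpretation obtained from `A` by letting the `i`-th letter of arity `zs.length` stand
for `ψ`, with argument variables `zs` and parameters evaluated by `g₀`. -/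
def KripkeModel.substInterp (M : KripkeModel) (A : M.W → ℕ → List M.U → Prop) (i : ℕ)
    (zs : List ℕ) (ψ : Formula) (g₀ : ℕ → M.U) : M.W → ℕ → List M.U → Prop := fun w j l =>
  if j = i ∧ l.length = zs.length then
    M.ForcesA A ψ w fun u => if u ∈ zs then l.getD (zs.idxOf u) (g₀ u) else g₀ u
  else A w j l

theorem forcesA_substAux (M : KripkeModel) (A : M.W → ℕ → List M.U → Prop) (i : ℕ) (zs : List ℕ)
    (ψ : Formula) (g₀ : ℕ → M.U) (φ : Formula) (f : ℕ → ℕ) (w : M.W) (g : ℕ → M.U)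
    (hg : ∀ u ∈ ψ.fv \ zs.toFinset, g u = g₀ u) :
    M.ForcesA A (Formula.substAux i zs ψ f φ) w g ↔
      M.ForcesA (M.substInterp A i zs ψ g₀) φ w (g ∘ f) := by
  have key : ∀ (x : ℕ) (φ : Formula) (f : ℕ → ℕ) (g : ℕ → M.U) (d : M.U) (w : M.W) (z : ℕ),
      z ∉ (φ.fv.erase x).image f ∪ (ψ.fv \ zs.toFinset) →
      (M.ForcesA (M.substInterp A i zs ψ g₀) φ w (Function.update g z d ∘ Function.update f x z) ↔
      M.ForcesA (M.substInterp A i zs ψ g₀) φ w (Function.update (g ∘ f) x d)) := by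
    intro x φ f g d w z hz
    refine forcesA_congr M _ φ fun y hy => ?_
    by_cases hyx : y = x
    · simp [hyx]
    · have : f y ≠ z := fun h =>
        hz (Finset.mem_union_left _ (h ▸ Finset.mem_image_of_mem f (by simp [hyx, hy])))
      simp [hyx, this]
  have key' : ∀ (g : ℕ → M.U), (∀ u ∈ ψ.fv \ zs.toFinset, g u = g₀ u) →
      ∀ (S : Finset ℕ) (z : ℕ) (d : M.U), z ∉ S ∪ (ψ.fv \ zs.toFinset) →
      ∀ u ∈ ψ.fv \ zs.toFinset, Function.update g z d u = g₀ u := by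
    intro g hg S z d hz u hu
    have : u ≠ z := fun h => hz (Finset.mem_union_right _ (h ▸ hu))
    simp only [Function.update_of_ne this, hg u hu]
  induction φ generalizing f w g with
  | bot => rfl
  | atom j xs =>
    simp only [Formula.substAux, KripkeModel.ForcesA, KripkeModel.substInterp, List.length_map]
    split_ifs with h
    · rw [forcesA_rename]
      refine forcesA_congr M A ψ fun u hu => ?_
      by_cases huz : u ∈ zs
      · have hlt : zs.idxOf u < xs.length := h.2 ▸ List.idxOf_lt_length_of_mem huz
        simp [Formula.assign, huz, List.getD_eq_getElem?_getD, hlt]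
      · simpa [Formula.assign, huz] using hg u (by simp [hu, huz])
    · simp [KripkeModel.ForcesA]
  | and φ χ h1 h2 =>
    simp only [Formula.substAux, KripkeModel.ForcesA, h1 _ _ _ hg, h2 _ _ _ hg]
  | or φ χ h1 h2 =>
    simp only [Formula.substAux, KripkeModel.ForcesA, h1 _ _ _ hg, h2 _ _ _ hg]
  | imp φ χ h1 h2 =>
    simp only [Formula.substAux, KripkeModel.ForcesA, h1 _ _ _ hg, h2 _ _ _ hg]
  | all x φ ih =>
    simp only [Formula.substAux, KripkeModel.ForcesA]
    refine forall₂_congr fun v _ => forall₂_congr fun d _ => ?_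
    exact (ih _ _ _ (key' g hg _ _ d (Formula.freshVar_notMem _ _))).trans
      (key x φ f g d v _ (Formula.freshVar_notMem _ _))
  | ex x φ ih =>
    simp only [Formula.substAux, KripkeModel.ForcesA]
    refine exists_congr fun d => and_congr_right fun _ => ?_
    exact (ih _ _ _ (key' g hg _ _ d (Formula.freshVar_notMem _ _))).trans
      (key x φ f g d w _ (Formula.freshVar_notMem _ _))

theorem forcesA_subst (M : KripkeModel) (A : M.W → ℕ → List M.U → Prop) (i : ℕ) (zs : List ℕ)
    (ψ φ : Formula) (w : M.W) (g : ℕ → M.U) :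
    M.ForcesA A (Formula.subst i zs ψ φ) w g ↔ M.ForcesA (M.substInterp A i zs ψ g) φ w g :=
  forcesA_substAux M A i zs ψ g φ id w g fun _ _ => rfl

/-- A strict upper bound for the indices of the predicate letters of a formula. -/
def Formula.letterBound : Formula → ℕ
  | bot => 0
  | atom i _ => i + 1
  | and φ ψ => max φ.letterBound ψ.letterBound
  | or φ ψ => max φ.letterBound ψ.letterBound
  | imp φ ψ => max φ.letterBound ψ.letterBound
  | all _ φ => φ.letterBound
  | ex _ φ => φ.letterBound

theorem forcesA_congr_interp (M : KripkeModel) {A B : M.W → ℕ → List M.U → Prop} (φ : Formula)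
    (H : ∀ w, ∀ i < φ.letterBound, ∀ l, A w i l ↔ B w i l) (w : M.W) (g : ℕ → M.U) :
    M.ForcesA A φ w g ↔ M.ForcesA B φ w g := by
  induction φ generalizing w g with
  | bot => rfl
  | atom i xs => exact H w i (Nat.lt_succ_self i) _
  | and φ ψ h1 h2 =>
    simp only [Formula.letterBound, lt_max_iff] at H
    simp only [KripkeModel.ForcesA, h1 fun w i hi => H w i (.inl hi), h2 fun w i hi => H w i (.inr hi)]
  | or φ ψ h1 h2 =>
    simp only [Formula.letterBound, lt_max_iff] at H
    simp only [KripkeModel.ForcesA, h1 fun w i hi => H w i (.inl hi), h2 fun w i hi => H w i (.inr hi)]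
  | imp φ ψ h1 h2 =>
    simp only [Formula.letterBound, lt_max_iff] at H
    simp only [KripkeModel.ForcesA, h1 fun w i hi => H w i (.inl hi), h2 fun w i hi => H w i (.inr hi)]
  | all x φ ih => simp only [KripkeModel.ForcesA, ih H]
  | ex x φ ih => simp only [KripkeModel.ForcesA, ih H]

theorem forcesA_subst_of_letterBound_le (M : KripkeModel) (A : M.W → ℕ → List M.U → Prop) {i : ℕ}
    (zs : List ℕ) (ψ : Formula) {φ : Formula} (hi : φ.letterBound ≤ i) (g₀ : ℕ → M.U) (w : M.W)
    (g : ℕ → M.U) :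
    M.ForcesA (M.substInterp A i zs ψ g₀) φ w g ↔ M.ForcesA A φ w g :=
  forcesA_congr_interp M φ (fun w j hj l => by
    rw [KripkeModel.substInterp, if_neg fun h => by omega]) w g

/-! ### Superintuitionistic logics -/

/-- It suffices to test intuitionistic validity under assignments all of whose values (not only
those of the free variables) lie in the domain of the world in question. -/
theorem mem_QInt_of_forall {φ : Formula}
    (h : ∀ (M : KripkeModel) (w : M.W) (g : ℕ → M.U), (∀ x, g x ∈ M.D w) → M.Forces φ w g) :
    φ ∈ QInt := by
  intro M w g hg
  classical
  obtain ⟨d, hd⟩ := M.D_nonempty w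
  rw [forces_congr M φ (h := fun x => if x ∈ φ.fv then g x else d) fun x hx => by simp [hx]]
  refine h M w _ fun x => ?_
  by_cases hx : x ∈ φ.fv <;> simp [hx, hd, hg]

namespace IsSuperintuitionisticLogic
variable {L : Set Formula} (hL : IsSuperintuitionisticLogic L)
include hL

theorem mem_of_forall {φ ψ : Formula} (hφ : φ ∈ L)
    (h : ∀ (M : KripkeModel) (w : M.W) (g : ℕ → M.U), (∀ x, g x ∈ M.D w) → M.Forces φ w g →
      M.Forces ψ w g) : ψ ∈ L :=
  hL.modusPonens hφ <| hL.qInt_subset <| mem_QInt_of_forall fun M _ g hg v hwv =>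
    h M v g fun x => M.D_mono hwv (hg x)

theorem and_mem {φ ψ : Formula} (hφ : φ ∈ L) (hψ : ψ ∈ L) : .and φ ψ ∈ L :=
  hL.modusPonens hψ <| hL.modusPonens hφ <| hL.qInt_subset fun M _ _ _ _ _ h _ hvu h' =>
    ⟨forces_mono M φ hvu h, h'⟩

theorem mem_of_forall₂ {φ ψ χ : Formula} (hφ : φ ∈ L) (hψ : ψ ∈ L)
    (h : ∀ (M : KripkeModel) (w : M.W) (g : ℕ → M.U), (∀ x, g x ∈ M.D w) → M.Forces φ w g →
      M.Forces ψ w g → M.Forces χ w g) : χ ∈ L :=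
  hL.mem_of_forall (hL.and_mem hφ hψ) fun M w g hg hh => h M w g hg hh.1 hh.2

/-- Substitution is sequential, so `q` is first renamed to a letter that does not occur in `φ`. -/
theorem lin_mem (hlin : linAxiom ∈ L) (φ ψ : Formula) : .or (.imp φ ψ) (.imp ψ φ) ∈ L := by
  set N := max 1 φ.letterBound with hN
  have h := hL.substitution N [] ψ List.nodup_nil <| hL.substitution 0 [] φ List.nodup_nil <|
    hL.substitution 1 [] (.atom N []) List.nodup_nil hlin
  refine hL.mem_of_forall h fun M _ g _ hf => ?_
  have h1 : N ≠ 0 := by omega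
  have e : ∀ v, M.ForcesA (M.substInterp M.interp N [] ψ g) φ v g ↔ M.ForcesA M.interp φ v g :=
    fun v => forcesA_subst_of_letterBound_le M _ _ _ (le_max_right _ _) _ _ _
  simpa [forces_iff_forcesA, forcesA_subst, linAxiom, KripkeModel.ForcesA, KripkeModel.substInterp,
    h1, e] using hf

theorem cd_mem (hcd : cdAxiom ∈ L) (φ ψ : Formula) {y : ℕ} (hy : y ∉ ψ.fv) :
    .imp (.all y (.or φ ψ)) (.or (.all y φ) ψ) ∈ L := by
  set N := max 1 φ.letterBound with hN
  have h := hL.substitution N [] ψ List.nodup_nil <|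
    hL.substitution 0 [y] φ (List.nodup_singleton y) <|
    hL.substitution 0 [] (.atom N []) List.nodup_nil hcd
  refine hL.mem_of_forall h fun M _ g _ hf => ?_
  have h1 : N ≠ 0 := by omega
  have e : ∀ v d, M.ForcesA (M.substInterp M.interp N [] ψ g) φ v
        (fun u => if u = y then ([d] : List M.U)[([y] : List ℕ).idxOf u]?.getD (g u) else g u) ↔
      M.ForcesA M.interp φ v (Function.update g y d) := fun v d => by
    rw [forcesA_subst_of_letterBound_le M _ _ _ (le_max_right _ _) _ _ _]
    refine forcesA_congr M _ _ fun u _ => ?_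
    by_cases hu : u = y <;> simp [hu]
  have e2 : ∀ v d, M.ForcesA M.interp ψ v (Function.update g y d) ↔ M.ForcesA M.interp ψ v g :=
    fun v d => forcesA_congr M _ _ fun u hu => by
      rw [Function.update_of_ne (ne_of_mem_of_not_mem hu hy)]
  simpa [forces_iff_forcesA, forcesA_subst, cdAxiom, KripkeModel.ForcesA, KripkeModel.substInterp,
    h1, e, e2] using hf

end IsSuperintuitionisticLogic

theorem subset_extend (L Γ : Set Formula) : L ∪ Γ ⊆ extend L Γ := fun _ h _ _ h' => h' h

theorem extend_isSuperintuitionisticLogic {L : Set Formula} (Γ : Set Formula) (hL : QInt ⊆ L) :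
    IsSuperintuitionisticLogic (extend L Γ) where
  qInt_subset := fun _ h => subset_extend L Γ (.inl (hL h))
  modusPonens := fun h1 h2 L' hL' h => hL'.modusPonens (h1 L' hL' h) (h2 L' hL' h)
  substitution := fun i zs ψ hz h1 L' hL' h => hL'.substitution i zs ψ hz (h1 L' hL' h)
  generalization := fun x h1 L' hL' h => hL'.generalization x (h1 L' hL' h)

theorem QLCcd_isSuperintuitionisticLogic : IsSuperintuitionisticLogic QLCcd :=
  extend_isSuperintuitionisticLogic _ fun _ h => subset_extend _ _ (.inl h)

theorem linAxiom_mem_QLCcd : linAxiom ∈ QLCcd :=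
  subset_extend _ _ (.inl (subset_extend _ _ (.inr rfl)))

theorem cdAxiom_mem_QLCcd : cdAxiom ∈ QLCcd := subset_extend _ _ (.inr rfl)

/-! ### Linear Kripke models with constant domains -/

/-- Linearly ordered Kripke models in which every individual exists at every world. -/
structure KripkeModel.IsLinearConstant (M : KripkeModel) : Prop where
  total : ∀ w v : M.W, w ≤ v ∨ v ≤ w
  domain : ∀ w d, d ∈ M.D w

/-- Replace the interpretation of the predicate letters in a model with constant domain. -/
def KripkeModel.withInterp (M : KripkeModel) (hM : M.IsLinearConstant)
    (A : M.W → ℕ → List M.U → Prop) (hA : ∀ {w v : M.W}, w ≤ v → ∀ i l, A w i l → A v i l) :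
    KripkeModel where
  W := M.W
  U := M.U
  D := M.D
  D_nonempty := M.D_nonempty
  D_mono := M.D_mono
  I w i := {l | A w i l}
  I_dom := fun _ d _ => hM.domain _ d
  I_mono := fun i h l hl => hA h i l hl

theorem forces_withInterp {M : KripkeModel} (hM : M.IsLinearConstant)
    {A : M.W → ℕ → List M.U → Prop} (hA : ∀ {w v : M.W}, w ≤ v → ∀ i l, A w i l → A v i l)
    (φ : Formula) (w : M.W) (g : ℕ → M.U) :
    (M.withInterp hM A hA).Forces φ w g ↔ M.ForcesA A φ w g := by
  induction φ generalizing w g with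
  | bot => rfl
  | atom i xs => rfl
  | and φ ψ h1 h2 => exact and_congr (h1 _ _) (h2 _ _)
  | or φ ψ h1 h2 => exact or_congr (h1 _ _) (h2 _ _)
  | imp φ ψ h1 h2 => exact forall₂_congr fun v _ => imp_congr (h1 _ _) (h2 _ _)
  | all x φ ih => exact forall₂_congr fun v _ => forall₂_congr fun d _ => ih _ _
  | ex x φ ih => exact exists_congr fun d => and_congr_right fun _ => ih _ _

/-- Soundness of `QLC.cd` for linear models with constant domain. The formulas true in all these
models are closed under substitution since the truth set of the substituted formula may replace the
interpretation of a letter. -/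
theorem valid_of_mem_QLCcd {φ : Formula} (hφ : φ ∈ QLCcd) {M : KripkeModel}
    (hM : M.IsLinearConstant) : M.Valid φ := by
  have hS : IsSuperintuitionisticLogic
      {φ | ∀ M : KripkeModel, M.IsLinearConstant → ∀ w g, M.Forces φ w g} := by
    refine ⟨fun φ h M hM w g => h M w g fun _ _ => hM.domain _ _,
      fun h1 h2 M hM w g => h2 M hM w g w le_rfl (h1 M hM w g), ?_,
      fun x h M hM w g v _ d _ => h M hM v _⟩
    intro φ i zs ψ _ h M hM w g
    have hmono : ∀ {w v : M.W}, w ≤ v → ∀ j l, M.substInterp M.interp i zs ψ g w j l →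
        M.substInterp M.interp i zs ψ g v j l := by
      intro w v hwv j l
      unfold KripkeModel.substInterp
      split_ifs
      · exact forcesA_mono M M.interp (fun h i _ hl => M.I_mono i h hl) ψ hwv
      · exact fun hl => M.I_mono j hwv hl
    rw [forces_iff_forcesA, forcesA_subst]
    exact (forces_withInterp hM hmono φ w g).1
      (h (M.withInterp hM _ hmono) ⟨hM.total, hM.domain⟩ w g)
  have hlin : linAxiom ∈ {φ | ∀ M : KripkeModel, M.IsLinearConstant → ∀ w g, M.Forces φ w g} := by
    intro M hM w g
    simp only [linAxiom, KripkeModel.Forces, List.map_nil]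
    by_contra! h
    obtain ⟨⟨v, -, h1, h2⟩, u, -, h3, h4⟩ := h
    rcases hM.total v u with hvu | hvu
    · exact h4 (M.I_mono _ hvu h1)
    · exact h2 (M.I_mono _ hvu h3)
  have hcd : cdAxiom ∈ {φ | ∀ M : KripkeModel, M.IsLinearConstant → ∀ w g, M.Forces φ w g} := by
    intro M hM w g v _ h
    simp only [KripkeModel.Forces, List.map_nil, List.map_cons, Function.update_self] at h ⊢
    by_contra! hc
    obtain ⟨⟨u, hvu, d, hd, h1⟩, h2⟩ := hc
    rcases h v le_rfl d (hM.domain _ _) with h | h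
    · exact h1 (M.I_mono _ hvu h)
    · exact h2 h
  have hQLC : QLC ⊆ _ := fun φ h => h _ hS <| Set.union_subset hS.qInt_subset (by simpa using hlin)
  exact fun w g _ => hφ _ hS (Set.union_subset hQLC (by simpa using hcd)) M hM w g

/-! ### Codes of formulas with parameters -/

namespace Formula

theorem code_surjective : Function.Surjective code := by
  intro n
  induction n using Nat.strong_induction_on with
  | _ n ih =>
    rcases Nat.eq_zero_or_pos n with rfl | hn
    · exact ⟨bot, rfl⟩
    have h1 : ((n - 1) / 6).unpair.1 ≤ (n - 1) / 6 := Nat.unpair_left_le _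
    have h2 : ((n - 1) / 6).unpair.2 ≤ (n - 1) / 6 := Nat.unpair_right_le _
    have e := Nat.pair_unpair ((n - 1) / 6)
    set p := ((n - 1) / 6).unpair.1
    set q := ((n - 1) / 6).unpair.2
    obtain ⟨φ, hφ⟩ := ih p (by omega)
    obtain ⟨ψ, hψ⟩ := ih q (by omega)
    have h6 : (n - 1) % 6 < 6 := Nat.mod_lt _ (by norm_num)
    have : (n - 1) % 6 = 0 ∨ (n - 1) % 6 = 1 ∨ (n - 1) % 6 = 2 ∨ (n - 1) % 6 = 3 ∨
      (n - 1) % 6 = 4 ∨ (n - 1) % 6 = 5 := by omega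
    rcases this with h | h | h | h | h | h
    · refine ⟨atom p (Denumerable.ofNat (List ℕ) q), ?_⟩
      have : Encodable.encode (Denumerable.ofNat (List ℕ) q) = q := Denumerable.encode_ofNat q
      rw [code, this, e]
      omega
    · exact ⟨and φ ψ, by rw [code, hφ, hψ, e]; omega⟩
    · exact ⟨or φ ψ, by rw [code, hφ, hψ, e]; omega⟩
    · exact ⟨imp φ ψ, by rw [code, hφ, hψ, e]; omega⟩
    · exact ⟨all p ψ, by rw [code, hψ, e]; omega⟩
    · exact ⟨ex p ψ, by rw [code, hψ, e]; omega⟩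

/-- The formula with a given Gödel number; every natural number is one. -/
noncomputable def ofCode : ℕ → Formula := Function.surjInv code_surjective

@[simp] theorem code_ofCode (n : ℕ) : (ofCode n).code = n := Function.surjInv_eq code_surjective n

@[simp] theorem ofCode_code (φ : Formula) : ofCode φ.code = φ := code_injective (code_ofCode _)

theorem fv_rename_subset (f : ℕ → ℕ) (φ : Formula) : (φ.rename f).fv ⊆ φ.fv.image f := by
  have key : ∀ (x z : ℕ) (f : ℕ → ℕ) (S T : Finset ℕ), T ⊆ S.image (Function.update f x z) →
      T.erase z ⊆ (S.erase x).image f := by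
    intro x z f S T h u hu
    rw [Finset.mem_erase] at hu
    obtain ⟨y, hy, rfl⟩ := Finset.mem_image.1 (h hu.2)
    by_cases hyx : y = x
    · simp [hyx] at hu
    · exact Finset.mem_image.2 ⟨y, by simp [hyx, hy], by simp [hyx]⟩
  induction φ generalizing f with
  | bot => simp [rename, fv]
  | atom i xs => intro u; simp [rename, fv]
  | and φ ψ h1 h2 =>
    simpa only [rename, fv, Finset.image_union] using Finset.union_subset_union (h1 f) (h2 f)
  | or φ ψ h1 h2 =>
    simpa only [rename, fv, Finset.image_union] using Finset.union_subset_union (h1 f) (h2 f)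
  | imp φ ψ h1 h2 =>
    simpa only [rename, fv, Finset.image_union] using Finset.union_subset_union (h1 f) (h2 f)
  | all x φ ih => exact key _ _ _ _ _ (ih _)
  | ex x φ ih => exact key _ _ _ _ _ (ih _)

end Formula

/-- The environment coded by `e = ⟨e₀, e₁⟩`: it sends `x₀` to `e₀` and `x₁` to `e₁`. The value at
the other variables is irrelevant for the two-variable fragment. -/
def env (e : ℕ) (x : ℕ) : ℕ :=
  if x = 0 then e.unpair.1 else if x = 1 then e.unpair.2 else 0

/-- The code of the environment `e` with the value at `x < 2` changed to `y`. -/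
def instEnv (x y e : ℕ) : ℕ :=
  if x = 0 then Nat.pair y e.unpair.2 else Nat.pair e.unpair.1 y

theorem env_instEnv {x : ℕ} (hx : x < 2) (y e : ℕ) :
    env (instEnv x y e) = Function.update (env e) x y := by
  funext u
  obtain rfl | rfl : x = 0 ∨ x = 1 := by omega
  · by_cases hu : u = 0 <;> simp [env, instEnv, hu]
  · by_cases hu : u = 0
    · simp [env, instEnv, hu]
    · by_cases hu1 : u = 1 <;> simp [env, instEnv, hu, hu1]

theorem env_le (e x : ℕ) : env e x ≤ e := by
  unfold env
  split_ifs
  exacts [Nat.unpair_left_le _, Nat.unpair_right_le _, Nat.zero_le _]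

/-- An *item* is a pair `⟨c, e⟩` of a Gödel number and an environment, coded by a number; it stands
for the formula with Gödel number `c` with its free variables replaced according to `e`. In this
way no substitution has to be carried out on Gödel numbers. -/
noncomputable def itemFormula (a : ℕ) : Formula :=
  (Formula.ofCode a.unpair.1).rename (env a.unpair.2)

theorem lt_of_mem_fv_itemFormula {a x : ℕ} (hx : x ∈ (itemFormula a).fv) : x ≤ a := by
  obtain ⟨y, -, rfl⟩ := Finset.mem_image.1 (Formula.fv_rename_subset _ _ hx)
  exact (env_le _ _).trans (Nat.unpair_right_le _)

theorem forces_item (M : KripkeModel) (c e : ℕ) (w : M.W) (g : ℕ → M.U) :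
    M.Forces (itemFormula (Nat.pair c e)) w g ↔ M.Forces (Formula.ofCode c) w (g ∘ env e) := by
  simp [itemFormula, forces_rename]

namespace Formula

theorem ofCode_bot : ofCode 0 = bot := ofCode_code bot

theorem ofCode_atom (i : ℕ) (xs : List ℕ) :
    ofCode (6 * Nat.pair i (Encodable.encode xs) + 1) = atom i xs := ofCode_code (atom i xs)

theorem ofCode_and (p q : ℕ) : ofCode (6 * Nat.pair p q + 2) = and (ofCode p) (ofCode q) :=
  code_injective (by simp [code])

theorem ofCode_or (p q : ℕ) : ofCode (6 * Nat.pair p q + 3) = or (ofCode p) (ofCode q) :=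
  code_injective (by simp [code])

theorem ofCode_imp (p q : ℕ) : ofCode (6 * Nat.pair p q + 4) = imp (ofCode p) (ofCode q) :=
  code_injective (by simp [code])

theorem ofCode_all (x q : ℕ) : ofCode (6 * Nat.pair x q + 5) = all x (ofCode q) :=
  code_injective (by simp [code])

theorem ofCode_ex (x q : ℕ) : ofCode (6 * Nat.pair x q + 6) = ex x (ofCode q) :=
  code_injective (by simp [code])

end Formula

/-! ### Henkin chains -/

/-- The designated witness for `b ⋠ ∀xψ`, where `a = ∀xψ`: it is larger than all parameters of
`a` and `b`. -/
def allWit (b a : ℕ) : ℕ := 2 * Nat.pair b a + 2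

/-- The designated witness for `∃xψ ⋠ b`, where `a = ∃xψ`. -/
def exWit (a b : ℕ) : ℕ := 2 * Nat.pair a b + 3

/-- An item with the value of a true formula. -/
def topItem : ℕ := Nat.pair (6 * Nat.pair 0 0 + 4) 0

/-- A Henkin chain is a total preorder `V` on items, read as a comparison of truth values in a
linearly ordered Heyting algebra. The values of the connectives are the expected ones, and a
strict comparison with the value of a quantified formula is witnessed by an instance with a
designated parameter. -/
structure IsHenkinChain (V : ℕ → ℕ → Prop) : Prop where
  total : ∀ a b, V a b ∨ V b a
  trans : ∀ a b c, V a b → V b c → V a c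
  bot_le : ∀ e b, V (Nat.pair 0 e) b
  atom_le : ∀ i (xs ys : List ℕ) e e', xs.map (env e) = ys.map (env e') →
    V (Nat.pair (6 * Nat.pair i (Encodable.encode xs) + 1) e)
      (Nat.pair (6 * Nat.pair i (Encodable.encode ys) + 1) e')
  and_le_left : ∀ p q e, V (Nat.pair (6 * Nat.pair p q + 2) e) (Nat.pair p e)
  and_le_right : ∀ p q e, V (Nat.pair (6 * Nat.pair p q + 2) e) (Nat.pair q e)
  le_and : ∀ p q e s, V s (Nat.pair p e) → V s (Nat.pair q e) →
    V s (Nat.pair (6 * Nat.pair p q + 2) e)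
  left_le_or : ∀ p q e, V (Nat.pair p e) (Nat.pair (6 * Nat.pair p q + 3) e)
  right_le_or : ∀ p q e, V (Nat.pair q e) (Nat.pair (6 * Nat.pair p q + 3) e)
  or_le : ∀ p q e s, V (Nat.pair p e) s → V (Nat.pair q e) s →
    V (Nat.pair (6 * Nat.pair p q + 3) e) s
  le_imp : ∀ p q e s, V (Nat.pair p e) (Nat.pair q e) → V s (Nat.pair (6 * Nat.pair p q + 4) e)
  right_le_imp : ∀ p q e, V (Nat.pair q e) (Nat.pair (6 * Nat.pair p q + 4) e)
  imp_le : ∀ p q e, V (Nat.pair p e) (Nat.pair q e) ∨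
    V (Nat.pair (6 * Nat.pair p q + 4) e) (Nat.pair q e)
  all_le : ∀ x p e y, x < 2 →
    V (Nat.pair (6 * Nat.pair x p + 5) e) (Nat.pair p (instEnv x y e))
  le_all : ∀ x p e s, x < 2 →
    V s (Nat.pair p (instEnv x (allWit s (Nat.pair (6 * Nat.pair x p + 5) e)) e)) →
    V s (Nat.pair (6 * Nat.pair x p + 5) e)
  le_ex : ∀ x p e y, x < 2 →
    V (Nat.pair p (instEnv x y e)) (Nat.pair (6 * Nat.pair x p + 6) e)
  ex_le : ∀ x p e s, x < 2 →
    V (Nat.pair p (instEnv x (exWit (Nat.pair (6 * Nat.pair x p + 6) e) s) e)) s →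
    V (Nat.pair (6 * Nat.pair x p + 6) e) s

/-! ### Construction of a Henkin chain -/

/-- The conjunction of a list of formulas. -/
def conj : List Formula → Formula
  | [] => .imp .bot .bot
  | φ :: Γ => .and φ (conj Γ)

/-- The disjunction of a list of formulas. -/
def disj : List Formula → Formula
  | [] => .bot
  | φ :: Γ => .or φ (disj Γ)

theorem forces_conj (M : KripkeModel) (Γ : List Formula) (w : M.W) (g : ℕ → M.U) :
    M.Forces (conj Γ) w g ↔ ∀ φ ∈ Γ, M.Forces φ w g := by
  induction Γ with
  | nil => simp [conj, KripkeModel.Forces]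
  | cons φ Γ ih => simp [conj, KripkeModel.Forces, ih]

theorem forces_disj (M : KripkeModel) (Γ : List Formula) (w : M.W) (g : ℕ → M.U) :
    M.Forces (disj Γ) w g ↔ ∃ φ ∈ Γ, M.Forces φ w g := by
  induction Γ with
  | nil => simp [disj, KripkeModel.Forces]
  | cons φ Γ ih => simp [disj, KripkeModel.Forces, ih]

theorem fv_conj {Γ : List Formula} {x : ℕ} (h : x ∈ (conj Γ).fv) : ∃ φ ∈ Γ, x ∈ φ.fv := by
  induction Γ with
  | nil => simp [conj, Formula.fv] at h
  | cons φ Γ ih =>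
    rcases Finset.mem_union.1 h with h | h
    · exact ⟨φ, by simp, h⟩
    · obtain ⟨ψ, h1, h2⟩ := ih h
      exact ⟨ψ, by simp [h1], h2⟩

theorem fv_disj {Γ : List Formula} {x : ℕ} (h : x ∈ (disj Γ).fv) : ∃ φ ∈ Γ, x ∈ φ.fv := by
  induction Γ with
  | nil => simp [disj, Formula.fv] at h
  | cons φ Γ ih =>
    rcases Finset.mem_union.1 h with h | h
    · exact ⟨φ, by simp, h⟩
    · obtain ⟨ψ, h1, h2⟩ := ih h
      exact ⟨ψ, by simp [h1], h2⟩

/-- `Γ` does not entail `Δ` over `L`: no formula of the form `⋀Γ → ⋁Δ` is in `L`. -/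
def Consistent (L : Set Formula) (Γ Δ : List Formula) : Prop := .imp (conj Γ) (disj Δ) ∉ L

section
variable {L : Set Formula} (hL : IsSuperintuitionisticLogic L)
include hL

theorem Consistent.not_forall {Γ Δ : List Formula} (h : Consistent L Γ Δ) {χ : Formula}
    (hχ : χ ∈ L) : ¬ ∀ (M : KripkeModel) (w : M.W) (g : ℕ → M.U), (∀ x, g x ∈ M.D w) →
      M.Forces χ w g → (∀ φ ∈ Γ, M.Forces φ w g) → ∃ φ ∈ Δ, M.Forces φ w g := by
  intro H
  refine h (hL.mem_of_forall hχ fun M w g hg hw v hwv hv => ?_)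
  rw [forces_conj] at hv
  rw [forces_disj]
  exact H M v g (fun x => M.D_mono hwv (hg x)) (forces_mono M χ hwv hw) hv

theorem Consistent.cut {Γ Δ : List Formula} (h : Consistent L Γ Δ) (θ : Formula)
    (h' : ¬ Consistent L (θ :: Γ) Δ) : Consistent L Γ (θ :: Δ) := by
  intro h2
  refine h (hL.mem_of_forall₂ (not_not.1 h') h2 fun M w g _ h3 h4 v hwv hv => ?_)
  rcases h4 v hwv hv with h5 | h5
  · exact h3 v hwv ⟨h5, hv⟩
  · exact h5

/-- The constant domain axiom allows to add an instance with a fresh variable on the right. -/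
theorem Consistent.add_witness (hcd : cdAxiom ∈ L) {Γ Δ : List Formula} (h : Consistent L Γ Δ)
    {θ φ : Formula} (hθ : θ ∈ Δ) {y : ℕ} (hΓ : ∀ ψ ∈ Γ, y ∉ ψ.fv) (hΔ : ∀ ψ ∈ Δ, y ∉ ψ.fv)
    (H : ∀ (M : KripkeModel) (w : M.W) (g : ℕ → M.U), (∀ x, g x ∈ M.D w) →
      (∀ v, w ≤ v → ∀ d ∈ M.D v, M.Forces φ v (Function.update g y d)) → M.Forces θ w g) :
    Consistent L Γ (φ :: Δ) := by
  intro h2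
  have hc : y ∉ (disj Δ).fv := fun hy => by
    obtain ⟨ψ, h3, h4⟩ := fv_disj hy
    exact hΔ ψ h3 h4
  refine h (hL.mem_of_forall₂ (hL.generalization y h2) (hL.cd_mem hcd φ (disj Δ) hc)
    fun M w g hg h3 h4 v hwv hv => ?_)
  have h5 : ∀ u, v ≤ u → ∀ d ∈ M.D u, M.Forces (.or φ (disj Δ)) u (Function.update g y d) := by
    intro u hvu d hd
    refine h3 u (hwv.trans hvu) d hd u le_rfl ?_
    rw [forces_congr M (conj Γ) (h := g) fun x hx => ?_]
    · exact forces_mono M _ hvu hv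
    · obtain ⟨ψ, h6, h7⟩ := fv_conj hx
      rw [Function.update_of_ne]
      rintro rfl
      exact hΓ ψ h6 h7
  rcases h4 v hwv h5 with h6 | h6
  · rw [forces_disj]
    exact ⟨θ, hθ, H M v g (fun x => M.D_mono hwv (hg x)) h6⟩
  · exact h6

end

/-- The comparison of items that is treated at stage `k`. -/
noncomputable def comparison (k : ℕ) : Formula :=
  .imp (itemFormula k.unpair.1) (itemFormula k.unpair.2)

/-- The formulas added on the right when the comparison of `a` and `b` is rejected: if `b` is a
universal formula, `a → ψ(y)` for a fresh `y`. -/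
noncomputable def allWitness (a b : ℕ) : Formula :=
  match Formula.ofCode b.unpair.1 with
  | .all x ψ => if x < 2 then
      .imp (itemFormula a) (itemFormula (Nat.pair ψ.code (instEnv x (allWit a b) b.unpair.2)))
    else .bot
  | _ => .bot

/-- If `a` is an existential formula `∃xψ`, this is `ψ(y) → b` for a fresh `y`. -/
noncomputable def exWitness (a b : ℕ) : Formula :=
  match Formula.ofCode a.unpair.1 with
  | .ex x ψ => if x < 2 then
      .imp (itemFormula (Nat.pair ψ.code (instEnv x (exWit a b) a.unpair.2))) (itemFormula b)
    else .bot
  | _ => .bot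

open Classical in
/-- The stages of the construction: lists of accepted and of rejected formulas. -/
noncomputable def stage (L : Set Formula) (φ : Formula) : ℕ → List Formula × List Formula
  | 0 => ([], [φ])
  | k + 1 =>
    let s := stage L φ k
    if Consistent L (comparison k :: s.1) s.2 then (comparison k :: s.1, s.2)
    else (s.1, allWitness k.unpair.1 k.unpair.2 :: exWitness k.unpair.1 k.unpair.2 ::
      comparison k :: s.2)

/-- The comparison of `a` and `b` is accepted at its stage. -/
def Accepted (L : Set Formula) (φ : Formula) (a b : ℕ) : Prop :=
  Consistent L (comparison (Nat.pair a b) :: (stage L φ (Nat.pair a b)).1)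
    (stage L φ (Nat.pair a b)).2

theorem fv_comparison {k x : ℕ} (h : x ∈ (comparison k).fv) : x ≤ k := by
  rcases Finset.mem_union.1 h with h | h
  · exact (lt_of_mem_fv_itemFormula h).trans (Nat.unpair_left_le _)
  · exact (lt_of_mem_fv_itemFormula h).trans (Nat.unpair_right_le _)

theorem mem_fv_item {c e x : ℕ} (h : x ∈ (itemFormula (Nat.pair c e)).fv) : ∃ u, x = env e u := by
  obtain ⟨y, -, rfl⟩ := Finset.mem_image.1 (Formula.fv_rename_subset _ _ h)
  exact ⟨y, by simp⟩

theorem fv_item_instEnv {c e x y u : ℕ} (hx : x < 2)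
    (h : u ∈ (itemFormula (Nat.pair c (instEnv x y e))).fv) : u ≤ e ∨ u = y := by
  obtain ⟨v, rfl⟩ := mem_fv_item h
  rw [env_instEnv hx]
  by_cases hv : v = x
  · simp [hv]
  · simpa [hv] using .inl (env_le e v)

theorem fv_allWitness {a b x : ℕ} (h : x ∈ (allWitness a b).fv) :
    x ≤ Nat.pair a b ∨ x = allWit a b := by
  unfold allWitness at h
  split at h
  · split_ifs at h with hx
    · rcases Finset.mem_union.1 h with h | h
      · exact .inl ((lt_of_mem_fv_itemFormula h).trans (Nat.left_le_pair _ _))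
      · exact (fv_item_instEnv hx h).imp_left fun h =>
          h.trans ((Nat.unpair_right_le _).trans (Nat.right_le_pair _ _))
    · simp [Formula.fv] at h
  · simp [Formula.fv] at h

theorem fv_exWitness {a b x : ℕ} (h : x ∈ (exWitness a b).fv) :
    x ≤ Nat.pair a b ∨ x = exWit a b := by
  unfold exWitness at h
  split at h
  · split_ifs at h with hx
    · rcases Finset.mem_union.1 h with h | h
      · exact (fv_item_instEnv hx h).imp_left fun h =>
          h.trans ((Nat.unpair_right_le _).trans (Nat.left_le_pair _ _))
      · exact .inl ((lt_of_mem_fv_itemFormula h).trans (Nat.right_le_pair _ _))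
    · simp [Formula.fv] at h
  · simp [Formula.fv] at h

/-- Evaluation of an instance with a fresh parameter. -/
theorem update_comp_env_instEnv {U : Type} {x y e : ℕ} (hx : x < 2) (hy : e < y) (g : ℕ → U)
    (d : U) : Function.update g y d ∘ env (instEnv x y e) = Function.update (g ∘ env e) x d := by
  rw [env_instEnv hx]
  funext u
  by_cases hu : u = x
  · simp [hu]
  · have := env_le e u
    simp [hu, Function.update_of_ne (show env e u ≠ y by omega)]

theorem item_eta (a : ℕ) : Nat.pair (Formula.ofCode a.unpair.1).code a.unpair.2 = a := by simp

section
variable {L : Set Formula} (hL : IsSuperintuitionisticLogic L)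
include hL

theorem Consistent.add_bot {Γ Δ : List Formula} (h : Consistent L Γ Δ) :
    Consistent L Γ (.bot :: Δ) := fun h2 =>
  h (hL.mem_of_forall h2 fun _ _ _ _ h3 v hwv hv => (h3 v hwv hv).resolve_left id)

theorem Consistent.add_exWitness (hcd : cdAxiom ∈ L) {Γ Δ : List Formula} (h : Consistent L Γ Δ)
    {a b : ℕ} (hθ : .imp (itemFormula a) (itemFormula b) ∈ Δ)
    (hΓ : ∀ ψ ∈ Γ, exWit a b ∉ ψ.fv) (hΔ : ∀ ψ ∈ Δ, exWit a b ∉ ψ.fv) :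
    Consistent L Γ (exWitness a b :: Δ) := by
  unfold exWitness
  split
  · rename_i x ψ he
    split_ifs with hx
    · refine h.add_witness hL hcd hθ hΓ hΔ fun M w g hg H v hwv hv => ?_
      rw [← item_eta a, forces_item, he] at hv
      simp only [Formula.ofCode_code] at hv
      obtain ⟨d, hd, hv⟩ := hv
      have h1 := Nat.unpair_right_le a
      have h2 := Nat.left_le_pair a b
      have := H v hwv d hd v le_rfl (by
        rwa [forces_item, update_comp_env_instEnv hx (by unfold exWit; omega), Formula.ofCode_code])
      refine (forces_congr M _ fun u hu => ?_).1 this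
      have h3 := lt_of_mem_fv_itemFormula hu
      have h4 := Nat.right_le_pair a b
      exact Function.update_of_ne (by unfold exWit; omega) _ _
    · exact h.add_bot hL
  · exact h.add_bot hL

theorem Consistent.add_allWitness (hcd : cdAxiom ∈ L) {Γ Δ : List Formula} (h : Consistent L Γ Δ)
    {a b : ℕ} (hθ : .imp (itemFormula a) (itemFormula b) ∈ Δ)
    (hΓ : ∀ ψ ∈ Γ, allWit a b ∉ ψ.fv) (hΔ : ∀ ψ ∈ Δ, allWit a b ∉ ψ.fv) :
    Consistent L Γ (allWitness a b :: Δ) := by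
  unfold allWitness
  split
  · rename_i x ψ he
    split_ifs with hx
    · refine h.add_witness hL hcd hθ hΓ hΔ fun M w g hg H v hwv hv => ?_
      rw [← item_eta b, forces_item, he]
      simp only [Formula.ofCode_code]
      intro u hvu d hd
      have h1 := Nat.unpair_right_le b
      have h2 := Nat.right_le_pair a b
      have := H u (hwv.trans hvu) d hd u le_rfl (by
        refine (forces_congr M _ fun u hu => ?_).1 (forces_mono M _ hvu hv)
        have h3 := lt_of_mem_fv_itemFormula hu
        have h4 := Nat.left_le_pair a b
        exact (Function.update_of_ne (by unfold allWit; omega) _ _).symm)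
      rwa [forces_item, update_comp_env_instEnv hx (by unfold allWit; omega),
        Formula.ofCode_code] at this
    · exact h.add_bot hL
  · exact h.add_bot hL

end

theorem fv_stage {L : Set Formula} {φ : Formula} (hφ : ∀ x ∈ φ.fv, x < 2) (k : ℕ) :
    ∀ ψ ∈ (stage L φ k).1 ++ (stage L φ k).2, ∀ x ∈ ψ.fv, x < 2 * k + 2 := by
  induction k with
  | zero => simpa [stage] using hφ
  | succ k ih =>
    intro ψ hψ x hx
    have old : ψ ∈ (stage L φ k).1 ++ (stage L φ k).2 → x < 2 * (k + 1) + 2 := fun h =>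
      (ih ψ h x hx).trans (by omega)
    have new : ψ = comparison k → x < 2 * (k + 1) + 2 := by
      rintro rfl
      have := fv_comparison hx
      omega
    simp only [List.mem_append] at old
    simp only [stage] at hψ
    split_ifs at hψ
    · simp only [List.mem_append, List.mem_cons] at hψ
      tauto
    · simp only [List.mem_append, List.mem_cons] at hψ
      rcases hψ with h | rfl | rfl | h | h
      · exact old (.inl h)
      · rcases fv_allWitness hx with h | h
        · rw [Nat.pair_unpair] at h
          omega
        · rw [h, allWit, Nat.pair_unpair]
          omega
      · rcases fv_exWitness hx with h | h
        · rw [Nat.pair_unpair] at h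
          omega
        · rw [h, exWit, Nat.pair_unpair]
          omega
      · exact new h
      · exact old (.inr h)

section
variable {L : Set Formula} {φ : Formula}

theorem consistent_stage (hL : IsSuperintuitionisticLogic L) (hcd : cdAxiom ∈ L)
    (hφ : ∀ x ∈ φ.fv, x < 2) (h : φ ∉ L) (k : ℕ) :
    Consistent L (stage L φ k).1 (stage L φ k).2 := by
  induction k with
  | zero =>
    exact fun h2 => h <| hL.mem_of_forall h2 fun M w g _ h3 =>
      (h3 w le_rfl fun _ _ hb => hb).resolve_right id
  | succ k ih =>
    have hfv := fv_stage (L := L) hφ k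
    simp only [List.mem_append] at hfv
    simp only [stage]
    split_ifs with hk
    · exact hk
    · have h1 := ih.cut hL _ hk
      have hm : Formula.imp (itemFormula k.unpair.1) (itemFormula k.unpair.2) ∈
        comparison k :: (stage L φ k).2 := by simp [comparison]
      have e1 : exWit k.unpair.1 k.unpair.2 = 2 * k + 3 := by simp [exWit]
      have e2 : allWit k.unpair.1 k.unpair.2 = 2 * k + 2 := by simp [allWit]
      have h2 : Consistent L (stage L φ k).1
          (exWitness k.unpair.1 k.unpair.2 :: comparison k :: (stage L φ k).2) := by
        refine h1.add_exWitness hL hcd hm (fun ψ hψ hx => ?_) fun ψ hψ hx => ?_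
        · have := hfv ψ (.inl hψ) _ hx
          omega
        · rcases List.mem_cons.1 hψ with rfl | hψ
          · have := fv_comparison hx
            omega
          · have := hfv ψ (.inr hψ) _ hx
            omega
      refine h2.add_allWitness hL hcd (List.mem_cons_of_mem _ hm) (fun ψ hψ hx => ?_)
        fun ψ hψ hx => ?_
      · have := hfv ψ (.inl hψ) _ hx
        omega
      · rcases List.mem_cons.1 hψ with rfl | hψ
        · rcases fv_exWitness hx with h | h
          · rw [Nat.pair_unpair] at h
            omega
          · omega
        · rcases List.mem_cons.1 hψ with rfl | hψ
          · have := fv_comparison hx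
            omega
          · have := hfv ψ (.inr hψ) _ hx
            omega

theorem stage_mono {k m : ℕ} (h : k ≤ m) :
    (stage L φ k).1 ⊆ (stage L φ m).1 ∧ (stage L φ k).2 ⊆ (stage L φ m).2 := by
  induction m, h using Nat.le_induction with
  | base => exact ⟨List.Subset.refl _, List.Subset.refl _⟩
  | succ m _ ih =>
    simp only [stage]
    split_ifs
    · exact ⟨fun _ h => List.mem_cons_of_mem _ (ih.1 h), ih.2⟩
    · exact ⟨ih.1, fun _ h => List.mem_cons_of_mem _ (List.mem_cons_of_mem _
        (List.mem_cons_of_mem _ (ih.2 h)))⟩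

variable (L φ) in
/-- The formulas that are eventually accepted. -/
def AcceptedFormulas : Set Formula := {ψ | ∃ k, ψ ∈ (stage L φ k).1}

variable (L φ) in
/-- The formulas that are eventually rejected. -/
def RejectedFormulas : Set Formula := {ψ | ∃ k, ψ ∈ (stage L φ k).2}

theorem Accepted.mem {a b : ℕ} (h : Accepted L φ a b) :
    .imp (itemFormula a) (itemFormula b) ∈ AcceptedFormulas L φ := by
  refine ⟨Nat.pair a b + 1, ?_⟩
  rw [stage, if_pos (show Consistent _ _ _ from h)]
  simp [comparison]

theorem stage_succ_of_not_accepted {a b : ℕ} (h : ¬ Accepted L φ a b) :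
    (stage L φ (Nat.pair a b + 1)).2 = allWitness a b :: exWitness a b ::
      .imp (itemFormula a) (itemFormula b) :: (stage L φ (Nat.pair a b)).2 := by
  rw [stage, if_neg (show ¬ Consistent _ _ _ from h)]
  simp [comparison]

theorem mem_rejected_of_not_accepted {a b : ℕ} (h : ¬ Accepted L φ a b) :
    .imp (itemFormula a) (itemFormula b) ∈ RejectedFormulas L φ :=
  ⟨Nat.pair a b + 1, by simp [stage_succ_of_not_accepted h]⟩

/-- Finitely many accepted formulas do not entail the disjunction of finitely many rejected
formulas. -/
theorem not_forall_of_accepted (hL : IsSuperintuitionisticLogic L) (hcd : cdAxiom ∈ L)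
    (hφ : ∀ x ∈ φ.fv, x < 2) (h : φ ∉ L) {χ : Formula} (hχ : χ ∈ L) (Γ Δ : List Formula)
    (hΓ : ∀ ψ ∈ Γ, ψ ∈ AcceptedFormulas L φ) (hΔ : ∀ ψ ∈ Δ, ψ ∈ RejectedFormulas L φ)
    (H : ∀ (M : KripkeModel) (w : M.W) (g : ℕ → M.U), (∀ x, g x ∈ M.D w) →
      M.Forces χ w g → (∀ φ ∈ Γ, M.Forces φ w g) → ∃ φ ∈ Δ, M.Forces φ w g) : False := by
  have h1 : ∃ k, ∀ ψ ∈ Γ, ψ ∈ (stage L φ k).1 := by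
    clear H
    induction Γ with
    | nil => exact ⟨0, by simp⟩
    | cons ψ Γ ih =>
      simp only [List.mem_cons, forall_eq_or_imp] at hΓ ⊢
      obtain ⟨k, hk⟩ := ih hΓ.2
      obtain ⟨m, hm⟩ := hΓ.1
      exact ⟨max k m, (stage_mono (le_max_right _ _)).1 hm,
        fun χ hχ => (stage_mono (le_max_left _ _)).1 (hk χ hχ)⟩
  have h2 : ∃ k, ∀ ψ ∈ Δ, ψ ∈ (stage L φ k).2 := by
    clear H
    induction Δ with
    | nil => exact ⟨0, by simp⟩
    | cons ψ Γ ih =>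
      simp only [List.mem_cons, forall_eq_or_imp] at hΔ ⊢
      obtain ⟨k, hk⟩ := ih hΔ.2
      obtain ⟨m, hm⟩ := hΔ.1
      exact ⟨max k m, (stage_mono (le_max_right _ _)).2 hm,
        fun χ hχ => (stage_mono (le_max_left _ _)).2 (hk χ hχ)⟩
  obtain ⟨k, hk⟩ := h1
  obtain ⟨m, hm⟩ := h2
  refine (consistent_stage hL hcd hφ h (max k m)).not_forall hL hχ fun M w g hg hw hall => ?_
  obtain ⟨ψ, hψ, hf⟩ := H M w g hg hw fun ψ hψ =>
    hall ψ ((stage_mono (le_max_left _ _)).1 (hk ψ hψ))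
  exact ⟨ψ, (stage_mono (le_max_right _ _)).2 (hm ψ hψ), hf⟩

theorem allWitness_eq {x p e s : ℕ} (hx : x < 2) :
    allWitness s (Nat.pair (6 * Nat.pair x p + 5) e) = .imp (itemFormula s) (itemFormula
      (Nat.pair p (instEnv x (allWit s (Nat.pair (6 * Nat.pair x p + 5) e)) e))) := by
  simp [allWitness, Formula.ofCode_all, hx]

theorem exWitness_eq {x p e s : ℕ} (hx : x < 2) :
    exWitness (Nat.pair (6 * Nat.pair x p + 6) e) s = .imp (itemFormula
      (Nat.pair p (instEnv x (exWit (Nat.pair (6 * Nat.pair x p + 6) e) s) e))) (itemFormula s) := by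
  simp [exWitness, Formula.ofCode_ex, hx]

theorem isHenkinChain_accepted (hL : IsSuperintuitionisticLogic L) (hlin : linAxiom ∈ L)
    (hcd : cdAxiom ∈ L) (hφ : ∀ x ∈ φ.fv, x < 2) (h : φ ∉ L) : IsHenkinChain (Accepted L φ) := by
  have htop : Formula.imp .bot .bot ∈ L := hL.qInt_subset fun _ _ _ _ _ _ h => h
  have R := fun {χ} (hχ : χ ∈ L) => not_forall_of_accepted hL hcd hφ h hχ
  -- a comparison that is forced at all worlds is accepted
  have R0 : ∀ {a b : ℕ}, (∀ (M : KripkeModel) (w : M.W) (g : ℕ → M.U), (∀ x, g x ∈ M.D w) →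
      M.Forces (itemFormula a) w g → M.Forces (itemFormula b) w g) → Accepted L φ a b := by
    intro a b H
    by_contra hc
    refine R htop [] [_] (by simp) (by simpa using mem_rejected_of_not_accepted hc) ?_
    intro M w g hg _ _
    exact ⟨_, List.mem_singleton_self _, fun v hwv hv => H M v g (fun x => M.D_mono hwv (hg x)) hv⟩
  -- a comparison entailed by one or two accepted comparisons is accepted
  have R1 : ∀ {a b a1 b1 : ℕ}, Accepted L φ a1 b1 →
      (∀ (M : KripkeModel) (w : M.W) (g : ℕ → M.U), (∀ x, g x ∈ M.D w) →
      (∀ v, w ≤ v → M.Forces (itemFormula a1) v g → M.Forces (itemFormula b1) v g) →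
      M.Forces (itemFormula a) w g → M.Forces (itemFormula b) w g) → Accepted L φ a b := by
    intro a b a1 b1 h1 H
    by_contra hc
    refine R htop [_] [_] (by simpa using h1.mem)
      (by simpa using mem_rejected_of_not_accepted hc) ?_
    intro M w g hg _ h1
    refine ⟨_, List.mem_singleton_self _, fun v hwv hv => H M v g (fun x => M.D_mono hwv (hg x))
      (fun u hvu => h1 _ (List.mem_singleton_self _) u (hwv.trans hvu)) hv⟩
  have R2 : ∀ {a b a1 b1 a2 b2 : ℕ}, Accepted L φ a1 b1 → Accepted L φ a2 b2 →
      (∀ (M : KripkeModel) (w : M.W) (g : ℕ → M.U), (∀ x, g x ∈ M.D w) →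
      (M.Forces (itemFormula a1) w g → M.Forces (itemFormula b1) w g) →
      (M.Forces (itemFormula a2) w g → M.Forces (itemFormula b2) w g) →
      M.Forces (itemFormula a) w g → M.Forces (itemFormula b) w g) → Accepted L φ a b := by
    intro a b a1 b1 a2 b2 h1 h2 H
    by_contra hc
    refine R htop [_, _] [_] (by simpa using And.intro h1.mem h2.mem)
      (by simpa using mem_rejected_of_not_accepted hc) ?_
    intro M w g hg _ h1
    simp only [List.mem_cons, List.not_mem_nil, or_false, forall_eq_or_imp, forall_eq] at h1
    exact ⟨_, List.mem_singleton_self _, fun v hwv hv => H M v g (fun x => M.D_mono hwv (hg x))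
      (h1.1 v hwv) (h1.2 v hwv) hv⟩
  -- if the disjunction of two comparisons is in the logic, then one of them is accepted
  have R3 : ∀ {a1 b1 a2 b2 : ℕ} {χ : Formula}, χ ∈ L →
      (∀ (M : KripkeModel) (w : M.W) (g : ℕ → M.U), (∀ x, g x ∈ M.D w) → M.Forces χ w g →
      M.Forces (.imp (itemFormula a1) (itemFormula b1)) w g ∨
      M.Forces (.imp (itemFormula a2) (itemFormula b2)) w g) →
      Accepted L φ a1 b1 ∨ Accepted L φ a2 b2 := by
    intro a1 b1 a2 b2 χ hχ H
    by_contra! hc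
    refine R hχ [] [_, _] (by simp) (by
      simpa using And.intro (mem_rejected_of_not_accepted hc.1)
        (mem_rejected_of_not_accepted hc.2)) ?_
    intro M w g hg hw _
    rcases H M w g hg hw with h | h
    · exact ⟨_, by simp, h⟩
    · exact ⟨_, List.mem_cons_of_mem _ (List.mem_singleton_self _), h⟩
  refine ⟨?_, ?_, ?_, ?_, ?_, ?_, ?_, ?_, ?_, ?_, ?_, ?_, ?_, ?_, ?_, ?_, ?_⟩
  · exact fun a b => R3 (hL.lin_mem hlin (itemFormula a) (itemFormula b)) fun M w g _ h => h
  · exact fun a b c h1 h2 => R2 h1 h2 fun M w g _ h1 h2 h => h2 (h1 h)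
  · intro e b
    refine R0 fun M w g _ h => ?_
    rw [forces_item, Formula.ofCode_bot] at h
    exact h.elim
  · intro i xs ys e e' he
    refine R0 fun M w g _ h => ?_
    rw [forces_item, Formula.ofCode_atom, KripkeModel.Forces, ← List.map_map] at h ⊢
    rwa [← he]
  · intro p q e
    refine R0 fun M w g _ h => ?_
    rw [forces_item, Formula.ofCode_and] at h
    rw [forces_item]
    exact h.1
  · intro p q e
    refine R0 fun M w g _ h => ?_
    rw [forces_item, Formula.ofCode_and] at h
    rw [forces_item]
    exact h.2
  · intro p q e s h1 h2
    refine R2 h1 h2 fun M w g _ h1 h2 h => ?_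
    rw [forces_item] at h1 h2
    rw [forces_item, Formula.ofCode_and]
    exact ⟨h1 h, h2 h⟩
  · intro p q e
    refine R0 fun M w g _ h => ?_
    rw [forces_item] at h
    rw [forces_item, Formula.ofCode_or]
    exact .inl h
  · intro p q e
    refine R0 fun M w g _ h => ?_
    rw [forces_item] at h
    rw [forces_item, Formula.ofCode_or]
    exact .inr h
  · intro p q e s h1 h2
    refine R2 h1 h2 fun M w g _ h1 h2 h => ?_
    rw [forces_item] at h1 h2
    rw [forces_item, Formula.ofCode_or] at h
    exact h.elim h1 h2
  · intro p q e s h1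
    refine R1 h1 fun M w g _ h1 h => ?_
    simp only [forces_item] at h1
    rw [forces_item, Formula.ofCode_imp]
    exact h1
  · intro p q e
    refine R0 fun M w g _ h => ?_
    rw [forces_item] at h
    rw [forces_item, Formula.ofCode_imp]
    exact fun v hwv _ => forces_mono M _ hwv h
  · intro p q e
    -- linearity applied to `p` and `p → q`
    refine R3 (hL.lin_mem hlin (itemFormula (Nat.pair p e))
      (itemFormula (Nat.pair (6 * Nat.pair p q + 4) e))) fun M w g _ h => ?_
    rcases h with h | h
    · refine .inl fun v hwv hv => ?_
      have := h v hwv hv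
      rw [forces_item] at hv ⊢
      rw [forces_item, Formula.ofCode_imp] at this
      exact this v le_rfl hv
    · refine .inr fun v hwv hv => ?_
      have := h v hwv hv
      rw [forces_item] at this ⊢
      rw [forces_item, Formula.ofCode_imp] at hv
      exact hv v le_rfl this
  · intro x p e y hx
    refine R0 fun M w g hg h => ?_
    rw [forces_item, Formula.ofCode_all] at h
    have := h w le_rfl _ (hg y)
    rwa [forces_item, env_instEnv hx, Function.comp_update]
  · intro x p e s hx h1
    by_contra hc
    refine R htop [_] [allWitness s (Nat.pair (6 * Nat.pair x p + 5) e)]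
      (by simpa using h1.mem) ?_ ?_
    · simp only [List.mem_singleton, forall_eq]
      exact ⟨_, by rw [stage_succ_of_not_accepted hc]; exact List.mem_cons_self⟩
    · intro M w g _ _ h
      rw [allWitness_eq hx]
      exact ⟨_, List.mem_singleton_self _, h _ (List.mem_singleton_self _)⟩
  · intro x p e y hx
    refine R0 fun M w g hg h => ?_
    rw [forces_item, Formula.ofCode_ex]
    rw [forces_item, env_instEnv hx, Function.comp_update] at h
    exact ⟨_, hg y, h⟩
  · intro x p e s hx h1
    by_contra hc
    refine R htop [_] [exWitness (Nat.pair (6 * Nat.pair x p + 6) e) s]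
      (by simpa using h1.mem) ?_ ?_
    · simp only [List.mem_singleton, forall_eq]
      exact ⟨_, by
        rw [stage_succ_of_not_accepted hc]
        exact List.mem_cons_of_mem _ List.mem_cons_self⟩
    · intro M w g _ _ h
      rw [exWitness_eq hx]
      exact ⟨_, List.mem_singleton_self _, h _ (List.mem_singleton_self _)⟩

/-- A formula outside of the logic is refuted by a Henkin chain. -/
theorem exists_isHenkinChain (hL : IsSuperintuitionisticLogic L) (hlin : linAxiom ∈ L)
    (hcd : cdAxiom ∈ L) {c : ℕ} (h : itemFormula (Nat.pair c (Nat.pair 0 1)) ∉ L) :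
    ∃ V, IsHenkinChain V ∧ ¬ V topItem (Nat.pair c (Nat.pair 0 1)) := by
  have hfv : ∀ x ∈ (itemFormula (Nat.pair c (Nat.pair 0 1))).fv, x < 2 := by
    intro x hx
    obtain ⟨u, rfl⟩ := mem_fv_item hx
    simp only [env, Nat.unpair_pair]
    split_ifs <;> omega
  refine ⟨_, isHenkinChain_accepted hL hlin hcd hfv h, fun hacc => ?_⟩
  refine not_forall_of_accepted hL hcd hfv h (hL.qInt_subset (mem_QInt_of_forall (φ := conj [])
    fun _ _ _ _ _ _ h => h)) [_] [_] (by simpa using hacc.mem)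
    (fun ψ hψ => ⟨0, hψ⟩) ?_
  intro M w g _ _ h
  refine ⟨_, List.mem_singleton_self _, h _ (List.mem_singleton_self _) w le_rfl ?_⟩
  rw [topItem, forces_item, Formula.ofCode_imp]
  exact fun _ _ h => h

end

/-! ### The Kripke model of a Henkin chain -/

namespace IsHenkinChain
variable {V : ℕ → ℕ → Prop}

theorem refl (hV : IsHenkinChain V) (a : ℕ) : V a a := (hV.total a a).elim id id

theorem le_top (hV : IsHenkinChain V) (a : ℕ) : V a topItem := hV.le_imp _ _ _ _ (hV.refl _)

end IsHenkinChain

/-- The worlds of the model: proper non-empty upper sets of the chain that respect the quantifiers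
as infinitary meets and joins of instances. -/
structure IsQuantifierCut (V : ℕ → ℕ → Prop) (T : Set ℕ) : Prop where
  upper : ∀ a b, a ∈ T → V a b → b ∈ T
  top_mem : topItem ∈ T
  bot_notMem : ∀ e, Nat.pair 0 e ∉ T
  exists_mem : ∀ x p e, x < 2 → Nat.pair (6 * Nat.pair x p + 6) e ∈ T →
    ∃ y, Nat.pair p (instEnv x y e) ∈ T
  all_mem : ∀ x p e, x < 2 → (∀ y, Nat.pair p (instEnv x y e) ∈ T) →
    Nat.pair (6 * Nat.pair x p + 5) e ∈ T

/-- One step of the nested interval construction: the open interval between `a` and `b` is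
shrunk so that every cut inside it respects the quantified formula `n`. -/
theorem IsHenkinChain.exists_subinterval {V : ℕ → ℕ → Prop} (hV : IsHenkinChain V) (n a b : ℕ)
    (hab : ¬ V b a) : ∃ a' b', ¬ V b' a' ∧ V a a' ∧ V b' b ∧
      (∀ x p e, x < 2 → n = Nat.pair (6 * Nat.pair x p + 6) e →
        V n a' ∨ ∃ y, V b' (Nat.pair p (instEnv x y e))) ∧
      (∀ x p e, x < 2 → n = Nat.pair (6 * Nat.pair x p + 5) e →
        V b' n ∨ ∃ y, V (Nat.pair p (instEnv x y e)) a') := by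
  by_cases hex : ∃ x p e, x < 2 ∧ n = Nat.pair (6 * Nat.pair x p + 6) e
  · obtain ⟨x, p, e, hx, rfl⟩ := hex
    have huniq : ∀ x' p' e', Nat.pair (6 * Nat.pair x p + 6) e =
        Nat.pair (6 * Nat.pair x' p' + 6) e' → x = x' ∧ p = p' ∧ e = e' := by
      intro x' p' e' h
      rw [Nat.pair_eq_pair] at h
      have h1 : Nat.pair x p = Nat.pair x' p' := by omega
      rw [Nat.pair_eq_pair] at h1
      exact ⟨h1.1, h1.2, h.2⟩
    have hne : ∀ x' p' e', Nat.pair (6 * Nat.pair x p + 6) e ≠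
        Nat.pair (6 * Nat.pair x' p' + 5) e' := by
      intro x' p' e' h
      rw [Nat.pair_eq_pair] at h
      omega
    by_cases h : V (Nat.pair (6 * Nat.pair x p + 6) e) a
    · exact ⟨a, b, hab, hV.refl _, hV.refl _, fun _ _ _ _ _ => .inl h,
        fun _ _ _ _ h => (hne _ _ _ h).elim⟩
    · have h1 := mt (hV.ex_le x p e a hx) h
      set i := Nat.pair p (instEnv x (exWit (Nat.pair (6 * Nat.pair x p + 6) e) a) e) with hi
      obtain ⟨b', h2, h3, h4⟩ : ∃ b', ¬ V b' a ∧ V b' b ∧ V b' i := by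
        rcases hV.total b i with h | h
        · exact ⟨b, hab, hV.refl _, h⟩
        · exact ⟨i, h1, h, hV.refl _⟩
      refine ⟨a, b', h2, hV.refl _, h3, fun x' p' e' _ h => .inr ?_,
        fun _ _ _ _ h => (hne _ _ _ h).elim⟩
      obtain ⟨rfl, rfl, rfl⟩ := huniq _ _ _ h
      exact ⟨_, h4⟩
  · by_cases hall : ∃ x p e, x < 2 ∧ n = Nat.pair (6 * Nat.pair x p + 5) e
    · obtain ⟨x, p, e, hx, rfl⟩ := hall
      have huniq : ∀ x' p' e', Nat.pair (6 * Nat.pair x p + 5) e =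
          Nat.pair (6 * Nat.pair x' p' + 5) e' → x = x' ∧ p = p' ∧ e = e' := by
        intro x' p' e' h
        rw [Nat.pair_eq_pair] at h
        have h1 : Nat.pair x p = Nat.pair x' p' := by omega
        rw [Nat.pair_eq_pair] at h1
        exact ⟨h1.1, h1.2, h.2⟩
      by_cases h : V b (Nat.pair (6 * Nat.pair x p + 5) e)
      · exact ⟨a, b, hab, hV.refl _, hV.refl _, fun x' p' e' hx' h => (hex ⟨x', p', e', hx', h⟩).elim,
          fun _ _ _ _ _ => .inl h⟩
      · have h1 := mt (hV.le_all x p e b hx) h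
        set i := Nat.pair p (instEnv x (allWit b (Nat.pair (6 * Nat.pair x p + 5) e)) e) with hi
        obtain ⟨a', h2, h3, h4⟩ : ∃ a', ¬ V b a' ∧ V a a' ∧ V i a' := by
          rcases hV.total a i with h | h
          · exact ⟨i, h1, h, hV.refl _⟩
          · exact ⟨a, hab, hV.refl _, h⟩
        refine ⟨a', b, h2, h3, hV.refl _, fun x' p' e' hx' h => (hex ⟨x', p', e', hx', h⟩).elim,
          fun x' p' e' _ h => .inr ?_⟩
        obtain ⟨rfl, rfl, rfl⟩ := huniq _ _ _ h
        exact ⟨_, h4⟩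
    · exact ⟨a, b, hab, hV.refl _, hV.refl _, fun x' p' e' hx' h => (hex ⟨x', p', e', hx', h⟩).elim,
        fun x' p' e' hx' h => (hall ⟨x', p', e', hx', h⟩).elim⟩

/-- Strictly comparable items are separated by a cut respecting all quantified formulas: the upper
set generated by the right end points of a sequence of nested intervals, the `n`-th of which takes
care of the item `n` (the Rasiowa–Sikorski argument). -/
theorem IsHenkinChain.exists_cut {V : ℕ → ℕ → Prop} (hV : IsHenkinChain V) {a b : ℕ}
    (hab : ¬ V b a) : ∃ T, IsQuantifierCut V T ∧ b ∈ T ∧ a ∉ T := by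
  choose! A B h1 h2 h3 h4 h5 using hV.exists_subinterval
  -- the `n`-th interval is obtained by treating the items `0, …, n - 1`
  let s : ℕ → ℕ × ℕ := fun n => Nat.rec (a, b) (fun n s => (A n s.1 s.2, B n s.1 s.2)) n
  have hs : ∀ n, s (n + 1) = (A n (s n).1 (s n).2, B n (s n).1 (s n).2) := fun n => rfl
  have hlt : ∀ n, ¬ V (s n).2 (s n).1 := by
    intro n
    induction n with
    | zero => exact hab
    | succ n ih => rw [hs]; exact h1 n _ _ ih
  have hmono : ∀ n m, n ≤ m → V (s n).1 (s m).1 ∧ V (s m).2 (s n).2 := by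
    intro n m h
    induction m, h using Nat.le_induction with
    | base => exact ⟨hV.refl _, hV.refl _⟩
    | succ m _ ih =>
      rw [hs]
      exact ⟨hV.trans _ _ _ ih.1 (h2 m _ _ (hlt m)), hV.trans _ _ _ (h3 m _ _ (hlt m)) ih.2⟩
  have hnot : ∀ n m, ¬ V (s n).2 (s m).1 := fun n m h =>
    hlt (max n m) <| hV.trans _ _ _ (hmono n _ (le_max_left _ _)).2 <|
      hV.trans _ _ _ h (hmono m _ (le_max_right _ _)).1
  refine ⟨{c | ∃ n, V (s n).2 c}, ⟨?_, ⟨0, hV.le_top _⟩, ?_, ?_, ?_⟩, ⟨0, hV.refl _⟩, ?_⟩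
  · rintro c d ⟨n, hn⟩ hcd
    exact ⟨n, hV.trans _ _ _ hn hcd⟩
  · rintro e ⟨n, hn⟩
    exact hlt n (hV.trans _ _ _ hn (hV.bot_le _ _))
  · rintro x p e hx ⟨n, hn⟩
    set k := Nat.pair (6 * Nat.pair x p + 6) e with hk
    rcases h4 k _ _ (hlt k) x p e hx hk with h | ⟨y, hy⟩
    · exact (hnot n (k + 1) (hV.trans _ _ _ hn h)).elim
    · exact ⟨y, k + 1, hy⟩
  · intro x p e hx hall
    set k := Nat.pair (6 * Nat.pair x p + 5) e with hk
    rcases h5 k _ _ (hlt k) x p e hx hk with h | ⟨y, hy⟩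
    · exact ⟨k + 1, h⟩
    · obtain ⟨n, hn⟩ := hall y
      exact (hnot n (k + 1) (hV.trans _ _ _ hn hy)).elim
  · rintro ⟨n, hn⟩
    exact hnot n 0 hn

/-- The Kripke model of a Henkin chain: the individuals are the parameters, and an atomic formula
is true at a cut if it belongs to it. -/
def IsHenkinChain.model {V : ℕ → ℕ → Prop} (_ : IsHenkinChain V) (T₀ : Set ℕ)
    (hT₀ : IsQuantifierCut V T₀) : KripkeModel where
  W := {T : Set ℕ // IsQuantifierCut V T}
  nonemptyW := ⟨⟨T₀, hT₀⟩⟩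
  U := ℕ
  D _ := Set.univ
  D_nonempty _ := Set.univ_nonempty
  D_mono _ := subset_rfl
  I T i := {l | ∃ (xs : List ℕ) (e : ℕ), xs.map (env e) = l ∧
    Nat.pair (6 * Nat.pair i (Encodable.encode xs) + 1) e ∈ T.1}
  I_dom _ d _ := Set.mem_univ d
  I_mono {T S} _ (hTS : T.1 ⊆ S.1) := fun _ ⟨xs, e, h, h1⟩ => ⟨xs, e, h, hTS h1⟩

theorem IsHenkinChain.isLinearConstant_model {V : ℕ → ℕ → Prop} (hV : IsHenkinChain V) (T₀ : Set ℕ)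
    (hT₀ : IsQuantifierCut V T₀) : (hV.model T₀ hT₀).IsLinearConstant where
  domain _ _ := Set.mem_univ _
  total T S := by
    by_contra! h
    obtain ⟨a, ha, ha'⟩ := Set.not_subset.1 h.1
    obtain ⟨b, hb, hb'⟩ := Set.not_subset.1 h.2
    rcases hV.total a b with h | h
    · exact hb' (T.2.upper _ _ ha h)
    · exact ha' (S.2.upper _ _ hb h)

/-- Truth at a cut is membership in the cut. -/
theorem IsHenkinChain.forces_model_iff {V : ℕ → ℕ → Prop} (hV : IsHenkinChain V) (T₀ : Set ℕ)
    (hT₀ : IsQuantifierCut V T₀) {φ : Formula} (hφ : φ.InFragment) (T : (hV.model T₀ hT₀).W)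
    (e : ℕ) : (hV.model T₀ hT₀).Forces φ T (env e) ↔ Nat.pair φ.code e ∈ T.1 := by
  induction φ generalizing T e with
  | bot => exact iff_of_false id (T.2.bot_notMem e)
  | atom i xs =>
    refine ⟨fun ⟨ys, e', h, h'⟩ => T.2.upper _ _ h' (hV.atom_le _ _ _ _ _ h),
      fun h => ⟨xs, e, rfl, h⟩⟩
  | and φ ψ h1 h2 =>
    simp only [KripkeModel.Forces, h1 hφ.1, h2 hφ.2, Formula.code]
    refine ⟨fun ⟨h, h'⟩ => ?_, fun h => ⟨T.2.upper _ _ h (hV.and_le_left _ _ _),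
      T.2.upper _ _ h (hV.and_le_right _ _ _)⟩⟩
    rcases hV.total (Nat.pair φ.code e) (Nat.pair ψ.code e) with hc | hc
    · exact T.2.upper _ _ h (hV.le_and _ _ _ _ (hV.refl _) hc)
    · exact T.2.upper _ _ h' (hV.le_and _ _ _ _ hc (hV.refl _))
  | or φ ψ h1 h2 =>
    simp only [KripkeModel.Forces, h1 hφ.1, h2 hφ.2, Formula.code]
    refine ⟨fun h => h.elim (fun h => T.2.upper _ _ h (hV.left_le_or _ _ _))
      fun h => T.2.upper _ _ h (hV.right_le_or _ _ _), fun h => ?_⟩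
    rcases hV.total (Nat.pair φ.code e) (Nat.pair ψ.code e) with hc | hc
    · exact .inr (T.2.upper _ _ h (hV.or_le _ _ _ _ hc (hV.refl _)))
    · exact .inl (T.2.upper _ _ h (hV.or_le _ _ _ _ (hV.refl _) hc))
  | imp φ ψ h1 h2 =>
    simp only [KripkeModel.Forces, h1 hφ.1, h2 hφ.2, Formula.code]
    refine ⟨fun h => ?_, fun h S hTS hS => ?_⟩
    · by_contra hc
      -- otherwise a cut between `ψ` and `φ` extends `T`
      have h3 : ¬ V (Nat.pair φ.code e) (Nat.pair ψ.code e) := fun h' =>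
        hc (T.2.upper _ _ T.2.top_mem (hV.le_imp _ _ _ _ h'))
      have h4 : Nat.pair ψ.code e ∉ T.1 := fun h' =>
        hc (T.2.upper _ _ h' (hV.right_le_imp _ _ _))
      obtain ⟨S, hS, h5, h6⟩ := hV.exists_cut h3
      rcases (hV.isLinearConstant_model T₀ hT₀).total T ⟨S, hS⟩ with h7 | h7
      · exact h6 (h _ h7 h5)
      · exact h4 (h T le_rfl (h7 h5))
    · rcases hV.imp_le φ.code ψ.code e with h3 | h3
      · exact S.2.upper _ _ hS h3
      · exact S.2.upper _ _ (hTS h) h3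
  | all x φ ih =>
    have key : ∀ (S : (hV.model T₀ hT₀).W) (d : ℕ), (hV.model T₀ hT₀).Forces φ S
        (Function.update (env e) x d) ↔ Nat.pair φ.code (instEnv x d e) ∈ S.1 := fun S d => by
      rw [← ih hφ.2, env_instEnv hφ.1]
      exact Iff.rfl
    refine ⟨fun h => T.2.all_mem _ _ _ hφ.1 fun y => (key T y).1 (h T le_rfl y (Set.mem_univ _)),
      fun h S hTS d _ => (key S d).2 (S.2.upper _ _ (hTS h) (hV.all_le _ _ _ _ hφ.1))⟩
  | ex x φ ih =>
    have key : ∀ (S : (hV.model T₀ hT₀).W) (d : ℕ), (hV.model T₀ hT₀).Forces φ S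
        (Function.update (env e) x d) ↔ Nat.pair φ.code (instEnv x d e) ∈ S.1 := fun S d => by
      rw [← ih hφ.2, env_instEnv hφ.1]
      exact Iff.rfl
    refine ⟨fun ⟨d, _, h⟩ => T.2.upper _ _ ((key T d).1 h) (hV.le_ex _ _ _ _ hφ.1), fun h => ?_⟩
    obtain ⟨y, hy⟩ := T.2.exists_mem _ _ _ hφ.1 h
    exact ⟨y, Set.mem_univ _, (key T y).2 hy⟩

/-- A formula refuted by a Henkin chain is not in `QLC.cd`. -/
theorem IsHenkinChain.notMem_QLCcd {V : ℕ → ℕ → Prop} (hV : IsHenkinChain V) {φ : Formula}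
    (hφ : φ.InFragment) (h : ¬ V topItem (Nat.pair φ.code (Nat.pair 0 1))) : φ ∉ QLCcd := by
  intro hmem
  obtain ⟨T, hT, -, h2⟩ := hV.exists_cut h
  exact h2 <| (hV.forces_model_iff T hT hφ ⟨T, hT⟩ _).1 <|
    valid_of_mem_QLCcd hmem (hV.isLinearConstant_model T hT) _ _ fun _ _ => Set.mem_univ _

/-- The item of a formula of the fragment under the environment `x₀ ↦ x₀`, `x₁ ↦ x₁` is
intuitionistically equivalent to the formula. -/
theorem forces_itemFormula_id {φ : Formula} (hφ : φ.InFragment) (M : KripkeModel) (w : M.W)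
    (g : ℕ → M.U) :
    M.Forces (itemFormula (Nat.pair φ.code (Nat.pair 0 1))) w g ↔ M.Forces φ w g := by
  have hfv : ∀ {φ : Formula}, φ.InFragment → ∀ x ∈ φ.fv, x < 2 := by
    intro φ hφ
    induction φ with
    | bot => simp [Formula.fv]
    | atom i xs => simpa [Formula.fv] using hφ.2
    | and φ ψ h1 h2 | or φ ψ h1 h2 | imp φ ψ h1 h2 =>
      intro x hx
      exact (Finset.mem_union.1 hx).elim (h1 hφ.1 x) (h2 hφ.2 x)
    | all y φ ih | ex y φ ih => exact fun x hx => ih hφ.2 x (Finset.mem_of_mem_erase hx)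
  rw [forces_item, Formula.ofCode_code]
  refine forces_congr M φ fun x hx => ?_
  have := hfv hφ x hx
  obtain rfl | rfl : x = 0 ∨ x = 1 := by omega
  all_goals simp [env]

theorem bot_notMem_QLCcd : Formula.bot ∉ QLCcd := fun h => by
  let M : KripkeModel :=
    { W := Unit
      U := Unit
      D := fun _ => Set.univ
      D_nonempty := fun _ => Set.univ_nonempty
      D_mono := fun _ => subset_rfl
      I := fun _ _ => ∅
      I_dom := fun h => h.elim
      I_mono := fun _ _ => subset_rfl }
  exact valid_of_mem_QLCcd h (M := M) ⟨fun _ _ => .inl le_rfl, fun _ _ => Set.mem_univ _⟩ ()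
    (fun _ => ()) fun _ _ => Set.mem_univ _

/-- A formula `φ` of the fragment is outside of `QLC.cd` if and only if it is refuted by a Henkin
chain. -/
theorem notMem_QLCcd_iff {φ : Formula} (hφ : φ.InFragment) : φ ∉ QLCcd ↔
    ∃ V, IsHenkinChain V ∧ ¬ V topItem (Nat.pair φ.code (Nat.pair 0 1)) := by
  refine ⟨fun h => ?_, fun ⟨V, hV, h⟩ => hV.notMem_QLCcd hφ h⟩
  refine exists_isHenkinChain QLCcd_isSuperintuitionisticLogic linAxiom_mem_QLCcd
    cdAxiom_mem_QLCcd fun h' => h ?_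
  exact QLCcd_isSuperintuitionisticLogic.mem_of_forall h' fun M w g _ =>
    (forces_itemFormula_id hφ M w g).1

theorem exists_isHenkinChain_of_QLCcd : ∃ V, IsHenkinChain V :=
  ((notMem_QLCcd_iff (φ := .bot) trivial).1 bot_notMem_QLCcd).imp fun _ h => h.1

/-! ### Recursive enumerability of propositional unsatisfiability -/

/-- By compactness of Cantor space, a computable set of clauses (a clause is a list of literals,
each of which is a propositional variable with the required value) is unsatisfiable if and only if
some finite part of it is refuted by all valuations of finitely many variables. -/
theorem rePred_unsatisfiable {clause : ℕ → ℕ → List (ℕ × Bool)} (hc : Primrec₂ clause) :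
    REPred fun n => ¬ ∃ v : ℕ → Bool, ∀ k, ∃ l ∈ clause n k, v l.1 = l.2 := by
  have hiff : ∀ n, (¬ ∃ v : ℕ → Bool, ∀ k, ∃ l ∈ clause n k, v l.1 = l.2) ↔
      ∃ N, ∀ s < 2 ^ N, ∃ k < N, ∀ l ∈ clause n k, l.1 < N ∧ ¬ (s / 2 ^ l.1 % 2 = l.2.toNat) := by
    intro n
    constructor
    · intro h
      push Not at h
      let U : ℕ → Set (ℕ → Bool) := fun k => {v | ∀ l ∈ clause n k, v l.1 ≠ l.2}
      have hU : ∀ k, IsOpen (U k) := by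
        intro k
        have : U k = ⋂ l ∈ (clause n k).toFinset, {v : ℕ → Bool | v l.1 ≠ l.2} := by
          ext v
          simp [U]
        rw [this]
        refine isOpen_biInter_finset fun l _ => ?_
        exact (isOpen_discrete {b : Bool | b ≠ l.2}).preimage
          (show Continuous fun v : ℕ → Bool => v l.1 from continuous_apply l.1)
      obtain ⟨F, hF⟩ := isCompact_univ.elim_finite_subcover U hU fun v _ => Set.mem_iUnion.2 (h v)
      -- a bound for the clauses of the finite subcover and the variables in them
      let N := F.sup fun k => k + 1 + ((clause n k).map fun l => l.1 + 1).sum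
      refine ⟨N, fun s _ => ?_⟩
      obtain ⟨k, hk⟩ := Set.mem_iUnion.1
        (hF (Set.mem_univ fun i => decide (s / 2 ^ i % 2 = 1)))
      obtain ⟨hkF, hk⟩ := Set.mem_iUnion.1 hk
      have hkN : k + 1 + ((clause n k).map fun l => l.1 + 1).sum ≤ N :=
        Finset.le_sup (f := fun k => k + 1 + ((clause n k).map fun l => l.1 + 1).sum) hkF
      refine ⟨k, by omega, fun l hl => ⟨?_, fun he => hk l hl ?_⟩⟩
      · have : l.1 + 1 ≤ ((clause n k).map fun l => l.1 + 1).sum :=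
          List.single_le_sum (by simp) _ (List.mem_map_of_mem hl)
        omega
      · simp only [he]
        cases l.2 <;> simp
    · rintro ⟨N, hN⟩ ⟨v, hv⟩
      -- the number whose first `N` binary digits are given by `v`
      have hs : ∀ N, ∃ s < 2 ^ N, ∀ i < N, s / 2 ^ i % 2 = (v i).toNat := by
        intro N
        induction N with
        | zero => exact ⟨0, by simp, by simp⟩
        | succ N ih =>
          obtain ⟨s, hs, h⟩ := ih
          have hb := Bool.toNat_le (v N)
          refine ⟨s + 2 ^ N * (v N).toNat, ?_, fun i hi => ?_⟩
          · rw [pow_succ]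
            nlinarith
          · rcases Nat.lt_succ_iff_lt_or_eq.1 hi with hi | rfl
            · obtain ⟨d, rfl⟩ := Nat.exists_eq_add_of_lt hi
              rw [show 2 ^ (i + d + 1) * (v (i + d + 1)).toNat =
                2 ^ i * (2 * (2 ^ d * (v (i + d + 1)).toNat)) by ring,
                Nat.add_mul_div_left _ _ (by positivity), Nat.add_mul_mod_self_left, h i hi]
            · rw [Nat.add_mul_div_left _ _ (by positivity), Nat.div_eq_of_lt hs]
              omega
      obtain ⟨s, hs, h⟩ := hs N
      obtain ⟨k, -, hk⟩ := hN s hs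
      obtain ⟨l, hl, hvl⟩ := hv k
      exact (hk l hl).2 ((h _ (hk l hl).1).trans (by rw [hvl]))
  have hpow : Primrec fun i : ℕ => 2 ^ i :=
    (Primrec.nat_rec₁ 1 (Primrec.nat_mul.comp .snd (.const 2)).to₂).of_eq fun n => by
      induction n with
      | zero => rfl
      | succ n ih => rw [pow_succ, ← ih]
  have htoNat : Primrec Bool.toNat := Primrec.dom_finite _
  have h1 : PrimrecRel fun (l : ℕ × Bool) (b : ℕ × ℕ) =>
      l.1 < b.1 ∧ ¬ (b.2 / 2 ^ l.1 % 2 = l.2.toNat) := by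
    refine PrimrecPred.and ?_ (PrimrecPred.not ?_)
    · exact Primrec.nat_lt.comp (Primrec.fst.comp .fst) (Primrec.fst.comp .snd)
    · exact Primrec.eq.comp (Primrec.nat_mod.comp (Primrec.nat_div.comp (Primrec.snd.comp .snd)
        (hpow.comp (Primrec.fst.comp .fst))) (.const 2)) (htoNat.comp (Primrec.snd.comp .fst))
  have h2 : PrimrecRel fun (k : ℕ) (b : ℕ × ℕ × ℕ) =>
      ∀ l ∈ clause b.1 k, l.1 < b.2.1 ∧ ¬ (b.2.2 / 2 ^ l.1 % 2 = l.2.toNat) :=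
    h1.forall_mem_list.comp (hc.comp (Primrec.fst.comp .snd) .fst) (Primrec.snd.comp .snd)
  have h3 : PrimrecRel fun (s : ℕ) (b : ℕ × ℕ) => ∃ k < b.2,
      ∀ l ∈ clause b.1 k, l.1 < b.2 ∧ ¬ (s / 2 ^ l.1 % 2 = l.2.toNat) :=
    (h2.exists_mem_list.comp (Primrec.list_range.comp (Primrec.snd.comp .snd))
      (Primrec.pair (Primrec.fst.comp .snd)
        (Primrec.pair (Primrec.snd.comp .snd) .fst))).of_eq fun b => by simp
  have h4 : PrimrecRel fun (n N : ℕ) => ∀ s < 2 ^ N, ∃ k < N,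
      ∀ l ∈ clause n k, l.1 < N ∧ ¬ (s / 2 ^ l.1 % 2 = l.2.toNat) :=
    (h3.forall_mem_list.comp (Primrec.list_range.comp (hpow.comp .snd)) .id).of_eq
      fun b => by simp
  classical
  have h5 : Partrec₂ fun n N : ℕ => Part.some (decide (∀ s < 2 ^ N, ∃ k < N,
      ∀ l ∈ clause n k, l.1 < N ∧ ¬ (s / 2 ^ l.1 % 2 = l.2.toNat))) :=
    (Primrec.to_comp h4.decide).partrec
  refine (Partrec.rfind h5).dom_re.of_eq fun n => ?_
  rw [hiff]
  refine Nat.rfind_dom.trans ?_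
  simp

/-! ### Henkin chains as satisfying valuations -/

/-- The literal saying that the comparison of `a` and `b` has truth value `t`. -/
def cmpLit (a b : ℕ) (t : Bool) : ℕ × Bool := (2 * Nat.pair a b, t)

/-- The literal for the proposition that the formula with Gödel number `m` is outside of the
two-variable fragment. -/
def outLit (m : ℕ) (t : Bool) : ℕ × Bool := (2 * m + 1, t)

/-- A clause that is always satisfied. -/
def tautClause : List (ℕ × Bool) := [(0, true), (0, false)]

/-- The clauses with parameters `p`, `q`, `r`, `s`, `t`. A valuation satisfies all of them if the
comparison literals describe a Henkin chain, the other literals hold of all formulas outside of the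
two-variable fragment only, and the formula with Gödel number `n` is outside of the fragment or
refuted by the chain. -/
def clauses (n p q r s t : ℕ) : List (List (ℕ × Bool)) := [
  tautClause,
  [cmpLit p q true, cmpLit q p true],
  [cmpLit p q false, cmpLit q r false, cmpLit p r true],
  [cmpLit (Nat.pair 0 p) q true],
  if (Denumerable.ofNat (List ℕ) q).map (env s) = (Denumerable.ofNat (List ℕ) r).map (env t) then
    [cmpLit (Nat.pair (6 * Nat.pair p q + 1) s) (Nat.pair (6 * Nat.pair p r + 1) t) true]
    else tautClause,
  [cmpLit (Nat.pair (6 * Nat.pair p q + 2) r) (Nat.pair p r) true],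
  [cmpLit (Nat.pair (6 * Nat.pair p q + 2) r) (Nat.pair q r) true],
  [cmpLit s (Nat.pair p r) false, cmpLit s (Nat.pair q r) false,
    cmpLit s (Nat.pair (6 * Nat.pair p q + 2) r) true],
  [cmpLit (Nat.pair p r) (Nat.pair (6 * Nat.pair p q + 3) r) true],
  [cmpLit (Nat.pair q r) (Nat.pair (6 * Nat.pair p q + 3) r) true],
  [cmpLit (Nat.pair p r) s false, cmpLit (Nat.pair q r) s false,
    cmpLit (Nat.pair (6 * Nat.pair p q + 3) r) s true],
  [cmpLit (Nat.pair p r) (Nat.pair q r) false, cmpLit s (Nat.pair (6 * Nat.pair p q + 4) r) true],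
  [cmpLit (Nat.pair q r) (Nat.pair (6 * Nat.pair p q + 4) r) true],
  [cmpLit (Nat.pair p r) (Nat.pair q r) true,
    cmpLit (Nat.pair (6 * Nat.pair p q + 4) r) (Nat.pair q r) true],
  [cmpLit (Nat.pair (6 * Nat.pair (p % 2) q + 5) r) (Nat.pair q (instEnv (p % 2) s r)) true],
  [cmpLit s (Nat.pair q
      (instEnv (p % 2) (allWit s (Nat.pair (6 * Nat.pair (p % 2) q + 5) r)) r)) false,
    cmpLit s (Nat.pair (6 * Nat.pair (p % 2) q + 5) r) true],
  [cmpLit (Nat.pair q (instEnv (p % 2) s r)) (Nat.pair (6 * Nat.pair (p % 2) q + 6) r) true],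
  [cmpLit (Nat.pair q
      (instEnv (p % 2) (exWit (Nat.pair (6 * Nat.pair (p % 2) q + 6) r) s) r)) s false,
    cmpLit (Nat.pair (6 * Nat.pair (p % 2) q + 6) r) s true],
  [outLit 0 false],
  [outLit (6 * Nat.pair p q + 2) false, outLit p true, outLit q true],
  [outLit (6 * Nat.pair p q + 3) false, outLit p true, outLit q true],
  [outLit (6 * Nat.pair p q + 4) false, outLit p true, outLit q true],
  [outLit (6 * Nat.pair (p % 2) q + 5) false, outLit q true],
  [outLit (6 * Nat.pair (p % 2) q + 6) false, outLit q true],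
  [outLit (6 * Nat.pair 0 (Encodable.encode [p % 2, q % 2]) + 1) false],
  [outLit (6 * Nat.pair p (Encodable.encode [q % 2]) + 1) false],
  [cmpLit topItem (Nat.pair n (Nat.pair 0 1)) false, outLit n true]]

/-- The `k`-th clause for the formula with Gödel number `n`. -/
def clause (n k : ℕ) : List (ℕ × Bool) :=
  (clauses n k.unpair.2.unpair.1 k.unpair.2.unpair.2.unpair.1
    k.unpair.2.unpair.2.unpair.2.unpair.1 k.unpair.2.unpair.2.unpair.2.unpair.2.unpair.1
    k.unpair.2.unpair.2.unpair.2.unpair.2.unpair.2).getD k.unpair.1 tautClause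

section primrec
variable {α : Type} [Primcodable α] {f g h : α → ℕ}

theorem primrec_cmpLit (hf : Primrec f) (hg : Primrec g) (t : Bool) :
    Primrec fun a => cmpLit (f a) (g a) t :=
  Primrec.pair (Primrec.nat_mul.comp (.const 2) (Primrec₂.natPair.comp hf hg)) (.const t)

theorem primrec_outLit (hf : Primrec f) (t : Bool) : Primrec fun a => outLit (f a) t :=
  Primrec.pair (Primrec.nat_add.comp (Primrec.nat_mul.comp (.const 2) hf) (.const 1)) (.const t)

theorem primrec_codePair (hf : Primrec f) (hg : Primrec g) (k : ℕ) :
    Primrec fun a => 6 * Nat.pair (f a) (g a) + k :=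
  Primrec.nat_add.comp (Primrec.nat_mul.comp (.const 6) (Primrec₂.natPair.comp hf hg)) (.const k)

theorem primrec_mod_two (hf : Primrec f) : Primrec fun a => f a % 2 :=
  Primrec.nat_mod.comp hf (.const 2)

theorem primrec_unpair_fst (hf : Primrec f) : Primrec fun a => (f a).unpair.1 :=
  Primrec.fst.comp (Primrec.unpair.comp hf)

theorem primrec_unpair_snd (hf : Primrec f) : Primrec fun a => (f a).unpair.2 :=
  Primrec.snd.comp (Primrec.unpair.comp hf)

theorem primrec_instEnv (hf : Primrec f) (hg : Primrec g) (hh : Primrec h) :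
    Primrec fun a => instEnv (f a) (g a) (h a) :=
  Primrec.ite (Primrec.eq.comp hf (.const 0))
    (Primrec₂.natPair.comp hg (primrec_unpair_snd hh))
    (Primrec₂.natPair.comp (primrec_unpair_fst hh) hg)

theorem primrec_allWit (hf : Primrec f) (hg : Primrec g) : Primrec fun a => allWit (f a) (g a) :=
  Primrec.nat_add.comp (Primrec.nat_mul.comp (.const 2) (Primrec₂.natPair.comp hf hg)) (.const 2)

theorem primrec_exWit (hf : Primrec f) (hg : Primrec g) : Primrec fun a => exWit (f a) (g a) :=
  Primrec.nat_add.comp (Primrec.nat_mul.comp (.const 2) (Primrec₂.natPair.comp hf hg)) (.const 3)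

theorem primrec_map_env (hf : Primrec f) (hg : Primrec g) :
    Primrec fun a => (Denumerable.ofNat (List ℕ) (f a)).map (env (g a)) := by
  refine Primrec.list_map ((Primrec.ofNat (List ℕ)).comp hf) ?_
  exact Primrec.ite (Primrec.eq.comp .snd (.const 0))
    (primrec_unpair_fst (hg.comp .fst))
    (Primrec.ite (Primrec.eq.comp .snd (.const 1)) (primrec_unpair_snd (hg.comp .fst)) (.const 0))

theorem primrec_clauses {n p q r s t : α → ℕ} (hn : Primrec n) (hp : Primrec p) (hq : Primrec q)
    (hr : Primrec r) (hs : Primrec s) (ht : Primrec t) :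
    Primrec fun a => clauses (n a) (p a) (q a) (r a) (s a) (t a) := by
  unfold clauses
  have hnil : Primrec fun _ : α => ([] : List (ℕ × Bool)) := .const _
  have hnil' : Primrec fun _ : α => ([] : List (List (ℕ × Bool))) := .const _
  repeat' first
    | exact hn
    | exact hp
    | exact hq
    | exact hr
    | exact hs
    | exact ht
    | exact hnil
    | exact hnil'
    | exact Primrec.const _
    | refine Primrec.list_cons.comp ?_ ?_
    | refine primrec_cmpLit ?_ ?_ _
    | refine primrec_outLit ?_ _
    | refine primrec_codePair ?_ ?_ _
    | refine primrec_mod_two ?_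
    | refine primrec_instEnv ?_ ?_ ?_
    | refine primrec_allWit ?_ ?_
    | refine primrec_exWit ?_ ?_
    | refine Primrec₂.natPair.comp ?_ ?_
    | refine Primrec.ite (Primrec.eq.comp (primrec_map_env ?_ ?_) (primrec_map_env ?_ ?_)) ?_ ?_
    | refine Primrec.encode.comp ?_

end primrec

theorem primrec_clause : Primrec₂ clause := by
  have h : Primrec fun x : ℕ × ℕ => x.2 := .snd
  have h1 := primrec_unpair_snd h
  have h2 := primrec_unpair_snd h1
  have h3 := primrec_unpair_snd h2
  have h4 := primrec_unpair_snd h3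
  exact (Primrec.list_getD tautClause).comp (primrec_clauses .fst (primrec_unpair_fst h1)
    (primrec_unpair_fst h2) (primrec_unpair_fst h3) (primrec_unpair_fst h4)
    (primrec_unpair_snd h4)) (primrec_unpair_fst h)

theorem forall_clause_iff {n : ℕ} {v : ℕ → Bool} :
    (∀ k, ∃ l ∈ clause n k, v l.1 = l.2) ↔
      ∀ p q r s t, ∀ c ∈ clauses n p q r s t, ∃ l ∈ c, v l.1 = l.2 := by
  constructor
  · intro h p q r s t c hc
    obtain ⟨i, hi, rfl⟩ := List.mem_iff_getElem.1 hc
    have := h (Nat.pair i (Nat.pair p (Nat.pair q (Nat.pair r (Nat.pair s t)))))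
    simpa [clause, List.getD_eq_getElem?_getD, hi] using this
  · intro h k
    rw [clause]
    by_cases hk : k.unpair.1 < (clauses n k.unpair.2.unpair.1 k.unpair.2.unpair.2.unpair.1
      k.unpair.2.unpair.2.unpair.2.unpair.1 k.unpair.2.unpair.2.unpair.2.unpair.2.unpair.1
      k.unpair.2.unpair.2.unpair.2.unpair.2.unpair.2).length
    · rw [List.getD_eq_getElem _ _ hk]
      exact h _ _ _ _ _ _ (List.getElem_mem hk)
    · rw [List.getD_eq_default _ _ (not_lt.1 hk)]
      cases hv : v 0
      · exact ⟨(0, false), by simp [tautClause], hv⟩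
      · exact ⟨(0, true), by simp [tautClause], hv⟩

theorem exists_satisfying_valuation {V : ℕ → ℕ → Prop} (hV : IsHenkinChain V) {n : ℕ}
    (hn : ¬ V topItem (Nat.pair n (Nat.pair 0 1)) ∨ ¬ (Formula.ofCode n).InFragment) :
    ∃ v : ℕ → Bool, ∀ k, ∃ l ∈ clause n k, v l.1 = l.2 := by
  classical
  let v : ℕ → Bool := fun i =>
    if i % 2 = 0 then decide (V (i / 2).unpair.1 (i / 2).unpair.2)
    else decide (¬ (Formula.ofCode (i / 2)).InFragment)
  have hc : ∀ a b, v (2 * Nat.pair a b) = decide (V a b) := fun a b => by simp [v]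
  have ho : ∀ m, v (2 * m + 1) = decide (¬ (Formula.ofCode m).InFragment) := fun m => by
    simp only [v, if_neg (show ¬ (2 * m + 1) % 2 = 0 by omega),
      show (2 * m + 1) / 2 = m by omega]
  have h2 : ∀ p, p % 2 < 2 := fun p => Nat.mod_lt _ (by norm_num)
  refine ⟨v, forall_clause_iff.2 fun p q r s t => ?_⟩
  simp only [clauses, List.forall_mem_cons]
  simp only [tautClause, cmpLit, outLit, hc, ho, List.mem_cons, exists_eq_or_imp, exists_eq_left,
    List.not_mem_nil, or_false, decide_eq_true_eq, decide_eq_false_iff_not, not_not, and_true,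
    false_imp_iff, implies_true]
  refine ⟨?_, hV.total _ _, ?_, hV.bot_le _ _, ?_, hV.and_le_left _ _ _, hV.and_le_right _ _ _, ?_,
    hV.left_le_or _ _ _, hV.right_le_or _ _ _, ?_, ?_, hV.right_le_imp _ _ _, hV.imp_le _ _ _,
    hV.all_le _ _ _ _ (h2 _), ?_, hV.le_ex _ _ _ _ (h2 _), ?_, ?_, ?_, ?_, ?_, ?_, ?_, ?_, ?_, hn⟩
  · cases v 0 <;> simp
  · exact not_or_of_imp fun h => not_or_of_imp fun h' => hV.trans _ _ _ h h'
  · split_ifs with he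
    · have := hV.atom_le p _ _ _ _ he
      simp only [Denumerable.encode_ofNat] at this
      simpa [hc] using this
    · cases h0 : v 0 <;> simp [h0]
  · exact not_or_of_imp fun h => not_or_of_imp fun h' => hV.le_and _ _ _ _ h h'
  · exact not_or_of_imp fun h => not_or_of_imp fun h' => hV.or_le _ _ _ _ h h'
  · exact not_or_of_imp fun h => hV.le_imp _ _ _ _ h
  · exact not_or_of_imp fun h => hV.le_all _ _ _ _ (h2 _) h
  · exact not_or_of_imp fun h => hV.ex_le _ _ _ _ (h2 _) h
  · rw [Formula.ofCode_bot]; trivial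
  · rw [Formula.ofCode_and, Formula.InFragment]; tauto
  · rw [Formula.ofCode_or, Formula.InFragment]; tauto
  · rw [Formula.ofCode_imp, Formula.InFragment]; tauto
  · rw [Formula.ofCode_all, Formula.InFragment]; have := h2 p; tauto
  · rw [Formula.ofCode_ex, Formula.InFragment]; have := h2 p; tauto
  · rw [Formula.ofCode_atom, Formula.InFragment]
    exact ⟨.inl ⟨rfl, rfl⟩, by simpa using And.intro (h2 p) (h2 q)⟩
  · rw [Formula.ofCode_atom, Formula.InFragment]
    exact ⟨.inr rfl, by simpa using h2 q⟩

theorem of_satisfying_valuation {n : ℕ} {v : ℕ → Bool}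
    (hv : ∀ k, ∃ l ∈ clause n k, v l.1 = l.2) (hn : (Formula.ofCode n).InFragment) :
    ∃ V, IsHenkinChain V ∧ ¬ V topItem (Nat.pair n (Nat.pair 0 1)) := by
  rw [forall_clause_iff] at hv
  simp only [clauses, List.forall_mem_cons] at hv
  simp only [cmpLit, outLit, List.mem_cons, exists_eq_or_imp,
    exists_eq_left, List.not_mem_nil, or_false, forall_and] at hv
  obtain ⟨-, h1, h2, h3, h4, h5, h6, h7, h8, h9, h10, h11, h12, h13, h14, h15, h16, h17, h18, h19,
    h20, h21, h22, h23, h24, h25, h26, -⟩ := hv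
  have hm : ∀ {x}, x < 2 → x % 2 = x := Nat.mod_eq_of_lt
  have out : ∀ φ : Formula, φ.InFragment → v (2 * φ.code + 1) = false := by
    intro φ hφ
    induction φ with
    | bot => exact h18 0 0 0 0 0
    | atom i xs =>
      obtain ⟨h | h, hx⟩ := hφ
      · obtain ⟨h, rfl⟩ := h
        obtain ⟨x, y, rfl⟩ := List.length_eq_two.1 h
        simpa [Formula.code, hm (hx x (by simp)), hm (hx y (by simp))] using h24 x y 0 0 0
      · obtain ⟨x, rfl⟩ := List.length_eq_one_iff.1 h
        simpa [Formula.code, hm (hx x (by simp))] using h25 i x 0 0 0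
    | and φ ψ ih ih' => simpa [Formula.code, ih hφ.1, ih' hφ.2] using h19 φ.code ψ.code 0 0 0
    | or φ ψ ih ih' => simpa [Formula.code, ih hφ.1, ih' hφ.2] using h20 φ.code ψ.code 0 0 0
    | imp φ ψ ih ih' => simpa [Formula.code, ih hφ.1, ih' hφ.2] using h21 φ.code ψ.code 0 0 0
    | all x φ ih => simpa [Formula.code, ih hφ.2, hm hφ.1] using h22 x φ.code 0 0 0
    | ex x φ ih => simpa [Formula.code, ih hφ.2, hm hφ.1] using h23 x φ.code 0 0 0
  have hmp : ∀ {a b : ℕ}, v a = false ∨ v b = true → v a = true → v b = true := by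
    intro a b h h'
    simpa [h'] using h
  refine ⟨fun a b => v (2 * Nat.pair a b) = true, ⟨?_, ?_, ?_, ?_, ?_, ?_, ?_, ?_, ?_, ?_, ?_, ?_,
    ?_, ?_, ?_, ?_, ?_⟩, ?_⟩
  · exact fun a b => h1 a b 0 0 0
  · intro a b c h h'
    simpa [h, h'] using h2 a b c 0 0
  · exact fun e b => h3 e b 0 0 0
  · intro i xs ys e e' he
    have := h4 i (Encodable.encode xs) (Encodable.encode ys) e e'
    rw [Denumerable.ofNat_encode, Denumerable.ofNat_encode, if_pos he] at this
    simpa using this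
  · exact fun p q e => h5 p q e 0 0
  · exact fun p q e => h6 p q e 0 0
  · intro p q e s h h'
    simpa [h, h'] using h7 p q e s 0
  · exact fun p q e => h8 p q e 0 0
  · exact fun p q e => h9 p q e 0 0
  · intro p q e s h h'
    simpa [h, h'] using h10 p q e s 0
  · exact fun p q e s => hmp (h11 p q e s 0)
  · exact fun p q e => h12 p q e 0 0
  · exact fun p q e => h13 p q e 0 0
  · intro x p e y hx
    simpa only [hm hx] using h14 x p e y 0
  · intro x p e s hx
    simpa only [hm hx] using hmp (h15 x p e s 0)
  · intro x p e y hx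
    simpa only [hm hx] using h16 x p e y 0
  · intro x p e s hx
    simpa only [hm hx] using hmp (h17 x p e s 0)
  · have := out _ hn
    rw [Formula.code_ofCode] at this
    simpa [this] using h26 0 0 0 0 0

/-- The two-variable fragment of `QLC.cd` is recursively enumerable. -/
theorem rePred_QLCcd :
    REPred fun n => n ∈ Formula.code '' {φ | φ ∈ QLCcd ∧ φ.InFragment} := by
  refine (rePred_unsatisfiable primrec_clause).of_eq fun n => ?_
  have hn : n ∈ Formula.code '' {φ | φ ∈ QLCcd ∧ φ.InFragment} ↔
      Formula.ofCode n ∈ QLCcd ∧ (Formula.ofCode n).InFragment :=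
    ⟨by rintro ⟨φ, hφ, rfl⟩; simpa using hφ, fun h => ⟨_, h, Formula.code_ofCode n⟩⟩
  rw [hn, ← not_iff_not, not_not, not_and_or]
  constructor
  · rintro ⟨v, hv⟩
    by_cases hf : (Formula.ofCode n).InFragment
    · exact .inl ((notMem_QLCcd_iff hf).2 (by simpa using of_satisfying_valuation hv hf))
    · exact .inr hf
  · intro h
    by_cases hf : (Formula.ofCode n).InFragment
    · obtain ⟨V, hV, h'⟩ := (notMem_QLCcd_iff hf).1 (h.resolve_right (not_not.2 hf))
      exact exists_satisfying_valuation hV (.inl (by simpa using h'))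
    · obtain ⟨V, hV⟩ := exists_isHenkinChain_of_QLCcd
      exact exists_satisfying_valuation hV (.inr hf)

/-! ### Horn rules over attributes, and their intuitionistic translation -/

/-- A classical structure with unary functions (attributes) to a set of values, and unary
predicates. -/
structure AttrModel (α β D Val : Type) where
  attr : α → D → Val
  pred : β → D → Prop

/-- Rules over attributes `α` and predicates `β`. They involve at most two elements at a time:
* `step P Q E`: for each `x` satisfying `P` there is a `y` satisfying `Q` with
  `a(y) = b(x)` for all `(a, b)` in `E`;
* `eq a b c d`: if `a(x) = b(y)`, then `c(x) = d(y)`;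
* `pred a b P q`: if `a(x) = b(y)` and `x` satisfies `P`, then `y` satisfies `q`. -/
inductive Rule (α β : Type) : Type
  | step (P Q : List β) (E : List (α × α)) : Rule α β
  | eq (a b c d : α) : Rule α β
  | pred (a b : α) (P : List β) (q : β) : Rule α β

section
variable {α β D Val : Type}

/-- The rule is true in the classical structure `S`. -/
def Rule.Holds (S : AttrModel α β D Val) : Rule α β → Prop
  | step P Q E => ∀ x, (∀ p ∈ P, S.pred p x) →
      ∃ y, (∀ q ∈ Q, S.pred q y) ∧ ∀ e ∈ E, S.attr e.1 y = S.attr e.2 x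
  | eq a b c d => ∀ x y, S.attr a x = S.attr b y → S.attr c x = S.attr d y
  | pred a b P q => ∀ x y, S.attr a x = S.attr b y → (∀ p ∈ P, S.pred p x) → S.pred q y

/-- The value `h(x)` is the `n`-th successor of a value marked by `z`, where an element `y` with
`h(y) = u` and `s(y) = v` witnesses that `v` is the successor of `u`. -/
def AttrModel.Chain (S : AttrModel α β D Val) (s h : α) (z : β) : ℕ → D → Prop
  | 0, x => S.pred z x
  | n + 1, x => ∃ y, S.attr s y = S.attr h x ∧ S.Chain s h z n y

/-- The atomic formula for the attribute with index `i` at the variable `x`. Its truth value plays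
the role of the value of the attribute. -/
def attrFormula (i x : ℕ) : Formula := .atom (2 * i) [x]

/-- The atomic formula for the predicate with index `j` at the variable `x`. -/
def predFormula (j x : ℕ) : Formula := .atom (2 * j + 1) [x]

/-- Equality of attributes, expressed as equality of truth values. -/
def eqFormula (a x b y : ℕ) : Formula :=
  .and (.imp (attrFormula a x) (attrFormula b y)) (.imp (attrFormula b y) (attrFormula a x))

/-- The conjunction of several predicates at the variable `x`. -/
def predsFormula (ib : β → ℕ) (P : List β) (x : ℕ) : Formula :=
  conj (P.map fun p => predFormula (ib p) x)

/-- The sentence saying that some element satisfies all predicates in `G`. -/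
def goalFormula (ib : β → ℕ) (G : List β) : Formula := .ex 0 (predsFormula ib G 0)

/-- The translation of a rule. The conclusion is weakened by the disjunct `γ`: at worlds where `γ`
is true, the rule imposes no condition. -/
def Rule.formula (ia : α → ℕ) (ib : β → ℕ) (γ : Formula) : Rule α β → Formula
  | step P Q E => .all 0 (.imp (predsFormula ib P 0) (.or (.ex 1 (.and (predsFormula ib Q 1)
      (conj (E.map fun e => eqFormula (ia e.1) 1 (ia e.2) 0)))) γ))
  | eq a b c d => .all 0 (.all 1 (.imp (eqFormula (ia a) 0 (ia b) 1)
      (.or (eqFormula (ia c) 0 (ia d) 1) γ)))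
  | pred a b P q => .all 0 (.all 1 (.imp (.and (eqFormula (ia a) 0 (ia b) 1) (predsFormula ib P 0))
      (.or (predFormula (ib q) 1) γ)))

/-- The translation of `AttrModel.Chain`, using the variables `x₀` and `x₁` alternately. -/
def chainFormula (s h z : ℕ) : ℕ → ℕ → Formula
  | 0, x => predFormula z x
  | n + 1, x => .ex (1 - x) (.and (eqFormula s (1 - x) h x) (chainFormula s h z n (1 - x)))

/-- The sentence saying that some element satisfies all predicates in `I` and carries the value
`n`. -/
def initFormula (ia : α → ℕ) (ib : β → ℕ) (I : List β) (s h : α) (z : β) (n : ℕ) : Formula :=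
  .ex 0 (.and (predsFormula ib I 0) (chainFormula (ia s) (ia h) (ib z) n 0))

/-- The formula saying that the rules and the initial condition imply the goal. -/
def reductionFormula (ia : α → ℕ) (ib : β → ℕ) (R : List (Rule α β)) (I G : List β) (s h : α)
    (z : β) (n : ℕ) : Formula :=
  .imp (.and (conj (R.map (Rule.formula ia ib (goalFormula ib G)))) (initFormula ia ib I s h z n))
    (goalFormula ib G)

theorem inFragment_conj {Γ : List Formula} (h : ∀ φ ∈ Γ, φ.InFragment) : (conj Γ).InFragment := by
  induction Γ with
  | nil => exact ⟨trivial, trivial⟩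
  | cons φ Γ ih => exact ⟨h φ (by simp), ih fun ψ hψ => h ψ (by simp [hψ])⟩

theorem inFragment_predFormula (j : ℕ) {x : ℕ} (hx : x < 2) : (predFormula j x).InFragment :=
  ⟨.inr rfl, by simpa using hx⟩

theorem inFragment_eqFormula (a b : ℕ) {x y : ℕ} (hx : x < 2) (hy : y < 2) :
    (eqFormula a x b y).InFragment := by
  have h1 : (attrFormula a x).InFragment := ⟨.inr rfl, by simpa using hx⟩
  have h2 : (attrFormula b y).InFragment := ⟨.inr rfl, by simpa using hy⟩
  exact ⟨⟨h1, h2⟩, h2, h1⟩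

theorem inFragment_predsFormula (ib : β → ℕ) (P : List β) {x : ℕ} (hx : x < 2) :
    (predsFormula ib P x).InFragment := by
  refine inFragment_conj fun φ hφ => ?_
  obtain ⟨p, -, rfl⟩ := List.mem_map.1 hφ
  exact inFragment_predFormula _ hx

theorem inFragment_goalFormula (ib : β → ℕ) (G : List β) : (goalFormula ib G).InFragment :=
  ⟨by norm_num, inFragment_predsFormula ib G (by norm_num)⟩

theorem inFragment_chainFormula (s h z n : ℕ) {x : ℕ} (hx : x < 2) :
    (chainFormula s h z n x).InFragment := by
  induction n generalizing x with
  | zero => exact inFragment_predFormula _ hx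
  | succ n ih =>
    have : 1 - x < 2 := by omega
    exact ⟨this, inFragment_eqFormula _ _ this hx, ih this⟩

theorem inFragment_reductionFormula (ia : α → ℕ) (ib : β → ℕ) (R : List (Rule α β))
    (I G : List β) (s h : α) (z : β) (n : ℕ) :
    (reductionFormula ia ib R I G s h z n).InFragment := by
  have h0 : 0 < 2 := by norm_num
  have h1 : 1 < 2 := by norm_num
  have hγ := inFragment_goalFormula ib G
  refine ⟨⟨inFragment_conj fun φ hφ => ?_, h0, inFragment_predsFormula ib I h0,
    inFragment_chainFormula _ _ _ _ h0⟩, hγ⟩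
  obtain ⟨r, -, rfl⟩ := List.mem_map.1 hφ
  cases r with
  | step P Q E =>
    refine ⟨h0, inFragment_predsFormula ib P h0, ⟨h1, inFragment_predsFormula ib Q h1,
      inFragment_conj fun φ hφ => ?_⟩, hγ⟩
    obtain ⟨e, -, rfl⟩ := List.mem_map.1 hφ
    exact inFragment_eqFormula _ _ h1 h0
  | eq a b c d =>
    exact ⟨h0, h1, inFragment_eqFormula _ _ h0 h1, inFragment_eqFormula _ _ h0 h1, hγ⟩
  | pred a b P q =>
    exact ⟨h0, h1, ⟨inFragment_eqFormula _ _ h0 h1, inFragment_predsFormula ib P h0⟩,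
      inFragment_predFormula _ h1, hγ⟩

theorem forces_predFormula (M : KripkeModel) (j x : ℕ) (w : M.W) (g : ℕ → M.U) :
    M.Forces (predFormula j x) w g ↔ [g x] ∈ M.I w (2 * j + 1) := Iff.rfl

theorem forces_predsFormula (M : KripkeModel) (ib : β → ℕ) (P : List β) (x : ℕ) (w : M.W)
    (g : ℕ → M.U) :
    M.Forces (predsFormula ib P x) w g ↔ ∀ p ∈ P, [g x] ∈ M.I w (2 * ib p + 1) := by
  simp [predsFormula, forces_conj, forces_predFormula]

theorem forces_goalFormula (M : KripkeModel) (ib : β → ℕ) (G : List β) (w : M.W) (g : ℕ → M.U) :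
    M.Forces (goalFormula ib G) w g ↔ ∃ d ∈ M.D w, ∀ p ∈ G, [d] ∈ M.I w (2 * ib p + 1) := by
  simp [goalFormula, KripkeModel.Forces, forces_predsFormula]

theorem forces_eqFormula (M : KripkeModel) (a x b y : ℕ) (w : M.W) (g : ℕ → M.U) :
    M.Forces (eqFormula a x b y) w g ↔
      {v | w ≤ v ∧ [g x] ∈ M.I v (2 * a)} = {v | w ≤ v ∧ [g y] ∈ M.I v (2 * b)} := by
  rw [Set.Subset.antisymm_iff]
  exact and_congr
    ⟨fun h v hv => ⟨hv.1, h v hv.1 hv.2⟩, fun h v hwv hv => (h ⟨hwv, hv⟩ : _ ∧ _).2⟩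
    ⟨fun h v hv => ⟨hv.1, h v hv.1 hv.2⟩, fun h v hwv hv => (h ⟨hwv, hv⟩ : _ ∧ _).2⟩

/-- The classical structure described by a world of a Kripke model: its elements are the
individuals of the world, and the value of an attribute is its truth value, i.e. the set of later
worlds at which the corresponding atomic formula is true. -/
def worldModel (ia : α → ℕ) (ib : β → ℕ) (M : KripkeModel) (w : M.W) :
    AttrModel α β (M.D w) (Set M.W) where
  attr a d := {v | w ≤ v ∧ [d.1] ∈ M.I v (2 * ia a)}
  pred b d := [d.1] ∈ M.I w (2 * ib b + 1)

theorem chain_worldModel {ia : α → ℕ} {ib : β → ℕ} {M : KripkeModel} {w : M.W} {s h : α} {z : β}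
    {n x : ℕ} (hx : x < 2) {g : ℕ → M.U} {d : M.D w} (hd : g x = d)
    (hf : M.Forces (chainFormula (ia s) (ia h) (ib z) n x) w g) :
    (worldModel ia ib M w).Chain s h z n d := by
  induction n generalizing x g d with
  | zero =>
    rw [chainFormula, forces_predFormula, hd] at hf
    exact hf
  | succ n ih =>
    obtain ⟨d', hd', h1, h2⟩ := hf
    have hne : x ≠ 1 - x := by omega
    refine ⟨⟨d', hd'⟩, ?_, ih (by omega) (by simp) h2⟩
    rw [forces_eqFormula] at h1
    simpa [worldModel, hne, hd] using h1

/-- If the rules and the initial condition imply the goal classically, then their translation is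
intuitionistically valid. -/
theorem reductionFormula_mem_QInt {ia : α → ℕ} {ib : β → ℕ} {R : List (Rule α β)} {I G : List β}
    {s h : α} {z : β} {n : ℕ}
    (H : ∀ (D Val : Type) (S : AttrModel α β D Val), (∀ r ∈ R, r.Holds S) →
      (∃ x, (∀ p ∈ I, S.pred p x) ∧ S.Chain s h z n x) → ∃ x, ∀ p ∈ G, S.pred p x) :
    reductionFormula ia ib R I G s h z n ∈ QInt := by
  intro M _ g _ w _ ⟨hR, hI⟩
  by_contra hγ
  rw [forces_conj] at hR
  refine hγ ((forces_goalFormula _ _ _ _ _).2 ?_)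
  -- as the goal is not true at `w`, the rules hold at `w` without the additional disjunct
  have hγ' : ∀ g', ¬ M.Forces (goalFormula ib G) w g' := fun g' h' =>
    hγ ((forces_goalFormula _ _ _ _ _).2 ((forces_goalFormula _ _ _ _ _).1 h'))
  have := H (M.D w) (Set M.W) (worldModel ia ib M w) (fun r hr => ?_) ?_
  · obtain ⟨d, hd⟩ := this
    exact ⟨d, d.2, hd⟩
  · have hr' := hR _ (List.mem_map_of_mem hr)
    cases r with
    | step P Q E =>
      intro d hP
      have h1 := (hr' w le_rfl d d.2 w le_rfl (by
        rw [forces_predsFormula]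
        simpa [worldModel] using hP)).resolve_right (hγ' _)
      obtain ⟨d', hd', h2, h3⟩ := h1
      rw [forces_predsFormula] at h2
      rw [forces_conj] at h3
      refine ⟨⟨d', hd'⟩, by simpa [worldModel] using h2, fun e he => ?_⟩
      have := h3 _ (List.mem_map_of_mem he)
      rw [forces_eqFormula] at this
      simpa [worldModel] using this
    | eq a b c d =>
      intro x y hxy
      have h1 := (hr' w le_rfl x x.2 w le_rfl y y.2 w le_rfl (by
        rw [forces_eqFormula]
        simpa [worldModel] using hxy)).resolve_right (hγ' _)
      rw [forces_eqFormula] at h1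
      simpa [worldModel] using h1
    | pred a b P q =>
      intro x y hxy hP
      have h1 := (hr' w le_rfl x x.2 w le_rfl y y.2 w le_rfl (by
        refine ⟨?_, ?_⟩
        · rw [forces_eqFormula]
          simpa [worldModel] using hxy
        · rw [forces_predsFormula]
          simpa [worldModel] using hP)).resolve_right (hγ' _)
      rw [forces_predFormula] at h1
      simpa [worldModel] using h1
  · obtain ⟨d, hd, h1, h2⟩ := hI
    rw [forces_predsFormula] at h1
    exact ⟨⟨d, hd⟩, by simpa [worldModel] using h1,
      chain_worldModel (by norm_num) (by simp) h2⟩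

/-- The Kripke model of a classical structure whose values are linearly ordered. At the root
`⊥`, the predicates are interpreted as in the structure; at all other worlds they are true
everywhere. An attribute with value `u` becomes true at the world `u`. -/
def AttrModel.kripke [LinearOrder Val] [Nonempty D] (S : AttrModel α β D Val) (ia : α → ℕ)
    (ib : β → ℕ) : KripkeModel where
  W := WithBot Val
  U := D
  D _ := Set.univ
  D_nonempty _ := Set.univ_nonempty
  D_mono _ := subset_rfl
  I w i := {l | (∃ a d, i = 2 * ia a ∧ l = [d] ∧ (S.attr a d : WithBot Val) ≤ w) ∨
    ∃ b d, i = 2 * ib b + 1 ∧ l = [d] ∧ (S.pred b d ∨ w ≠ ⊥)}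
  I_dom _ d _ := Set.mem_univ d
  I_mono := by
    rintro w v i hwv l (⟨a, d, h1, h2, h3⟩ | ⟨b, d, h1, h2, h3⟩)
    · exact .inl ⟨a, d, h1, h2, h3.trans hwv⟩
    · exact .inr ⟨b, d, h1, h2, h3.imp_right fun hw hv => hw (le_bot_iff.1 (hv ▸ hwv))⟩

section kripke
variable [LinearOrder Val] [Nonempty D] (S : AttrModel α β D Val) {ia : α → ℕ} {ib : β → ℕ}

theorem mem_kripke_attr (hia : Function.Injective ia) (w : WithBot Val) (a : α) (d : D) :
    [d] ∈ (S.kripke ia ib).I w (2 * ia a) ↔ (S.attr a d : WithBot Val) ≤ w := by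
  constructor
  · rintro (⟨a', d', h1, h2, h3⟩ | ⟨b, d', h1, -, -⟩)
    · obtain rfl := hia (show ia a = ia a' by omega)
      obtain rfl : d = d' := by simpa using h2
      exact h3
    · omega
  · exact fun h => .inl ⟨a, d, rfl, rfl, h⟩

theorem mem_kripke_pred (hib : Function.Injective ib) (w : WithBot Val) (b : β) (d : D) :
    [d] ∈ (S.kripke ia ib).I w (2 * ib b + 1) ↔ S.pred b d ∨ w ≠ ⊥ := by
  constructor
  · rintro (⟨a', d', h1, -, -⟩ | ⟨b', d', h1, h2, h3⟩)
    · omega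
    · obtain rfl := hib (show ib b = ib b' by omega)
      obtain rfl : d = d' := by simpa using h2
      exact h3
  · exact fun h => .inr ⟨b, d, rfl, rfl, h⟩

theorem forces_kripke_eqFormula (hia : Function.Injective ia) (a b : α) (x y : ℕ)
    (g : ℕ → D) :
    (S.kripke ia ib).Forces (eqFormula (ia a) x (ia b) y) (⊥ : WithBot Val) g ↔
      S.attr a (g x) = S.attr b (g y) := by
  refine (forces_eqFormula _ _ _ _ _ _ _).trans ?_
  have e : ∀ a x, {v : (S.kripke ia ib).W | (⊥ : WithBot Val) ≤ v ∧
      [g x] ∈ (S.kripke ia ib).I v (2 * ia a)} = Set.Ici (S.attr a (g x) : WithBot Val) := by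
    intro a x
    ext v
    refine (and_iff_right bot_le).trans (mem_kripke_attr S hia v a (g x))
  refine (Eq.congr (e a x) (e b y)).trans ?_
  exact (Set.Ici_inj (α := WithBot Val)).trans WithBot.coe_inj

theorem forces_kripke_chainFormula (hia : Function.Injective ia) (hib : Function.Injective ib)
    {s h : α} {z : β} {n x : ℕ} (hx : x < 2) {g : ℕ → D} (hc : S.Chain s h z n (g x)) :
    (S.kripke ia ib).Forces (chainFormula (ia s) (ia h) (ib z) n x) (⊥ : WithBot Val) g := by
  induction n generalizing x g with
  | zero => exact (mem_kripke_pred S hib _ _ _).2 (.inl hc)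
  | succ n ih =>
    obtain ⟨d, h1, h2⟩ := hc
    obtain rfl | rfl : x = 0 ∨ x = 1 := by omega
    · exact ⟨d, Set.mem_univ _, (forces_kripke_eqFormula S hia s h 1 0 _).2 h1,
        ih (by norm_num) (g := Function.update g 1 d) h2⟩
    · exact ⟨d, Set.mem_univ _, (forces_kripke_eqFormula S hia s h 0 1 _).2 h1,
        ih (by norm_num) (g := Function.update g 0 d) h2⟩

theorem forces_kripke_goalFormula (hib : Function.Injective ib) (G : List β) (w : WithBot Val)
    (g : ℕ → D) : (S.kripke ia ib).Forces (goalFormula ib G) w g ↔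
      (∃ d, ∀ p ∈ G, S.pred p d) ∨ w ≠ ⊥ := by
  refine (forces_goalFormula _ _ _ _ _).trans ?_
  constructor
  · rintro ⟨d, -, h⟩
    by_cases hw : w = ⊥
    · exact .inl ⟨d, fun p hp => ((mem_kripke_pred S hib w p d).1 (h p hp)).resolve_right
        (not_not.2 hw)⟩
    · exact .inr hw
  · rintro (⟨d, h⟩ | hw)
    · exact ⟨d, Set.mem_univ _, fun p hp => (mem_kripke_pred S hib w p d).2 (.inl (h p hp))⟩
    · obtain ⟨d⟩ := ‹Nonempty D›
      exact ⟨d, Set.mem_univ _, fun p _ => (mem_kripke_pred S hib w p d).2 (.inr hw)⟩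

/-- At the root the translation of a rule means the rule itself, and at all other worlds the
translation is true because the goal is. -/
theorem forces_kripke_rule (hia : Function.Injective ia) (hib : Function.Injective ib)
    (G : List β) {r : Rule α β} (hr : r.Holds S) (g : ℕ → D) :
    (S.kripke ia ib).Forces (r.formula ia ib (goalFormula ib G)) (⊥ : WithBot Val) g := by
  have hγ : ∀ (w : WithBot Val) (g : ℕ → D), w ≠ ⊥ →
      (S.kripke ia ib).Forces (goalFormula ib G) w g := fun w g hw =>
    (forces_kripke_goalFormula S hib G w g).2 (.inr hw)
  have hpreds : ∀ (P : List β) (x : ℕ) (g : ℕ → D),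
      (S.kripke ia ib).Forces (predsFormula ib P x) (⊥ : WithBot Val) g ↔
      ∀ p ∈ P, S.pred p (g x) := by
    intro P x g
    refine (forces_predsFormula _ _ _ _ _ _).trans (forall₂_congr fun p _ => ?_)
    exact (mem_kripke_pred S hib _ _ _).trans (or_iff_left (not_not.2 rfl))
  cases r with
  | step P Q E =>
    intro v _ d _ u _ hP
    by_cases hu : u = (⊥ : WithBot Val)
    · subst hu
      obtain ⟨y, hQ, hE⟩ := hr d ((hpreds _ _ _).1 hP)
      refine .inl ⟨y, Set.mem_univ _, (hpreds _ _ _).2 hQ, ?_⟩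
      refine (forces_conj _ _ _ _).2 fun φ hφ => ?_
      obtain ⟨e, he, rfl⟩ := List.mem_map.1 hφ
      exact (forces_kripke_eqFormula S hia _ _ _ _ _).2 (hE e he)
    · exact .inr (hγ _ _ hu)
  | eq a b c d =>
    intro v _ x _ v' _ y _ u _ h
    by_cases hu : u = (⊥ : WithBot Val)
    · subst hu
      have := hr x y ((forces_kripke_eqFormula S hia _ _ _ _ _).1 h)
      exact .inl ((forces_kripke_eqFormula S hia _ _ _ _ _).2 this)
    · exact .inr (hγ _ _ hu)
  | pred a b P q =>
    intro v _ x _ v' _ y _ u _ h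
    by_cases hu : u = (⊥ : WithBot Val)
    · subst hu
      have := hr x y ((forces_kripke_eqFormula S hia _ _ _ _ _).1 h.1)
        ((hpreds _ _ _).1 h.2)
      exact .inl ((mem_kripke_pred S hib _ _ _).2 (.inl this))
    · exact .inr (hγ _ _ hu)

end kripke

/-- If the rules and the initial condition do not imply the goal classically, then their
translation is not in `QLC.cd`. -/
theorem reductionFormula_notMem_QLCcd {ia : α → ℕ} {ib : β → ℕ} (hia : Function.Injective ia)
    (hib : Function.Injective ib) {R : List (Rule α β)} {I G : List β} {s h : α} {z : β} {n : ℕ}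
    (S : AttrModel α β D Val) (hR : ∀ r ∈ R, r.Holds S)
    (hI : ∃ x, (∀ p ∈ I, S.pred p x) ∧ S.Chain s h z n x) (hG : ¬ ∃ x, ∀ p ∈ G, S.pred p x) :
    reductionFormula ia ib R I G s h z n ∉ QLCcd := by
  intro hmem
  obtain ⟨d, hd, hc⟩ := hI
  have : Nonempty D := ⟨d⟩
  classical
  let _ : LinearOrder Val := linearOrderOfSTO (WellOrderingRel (α := Val))
  have hM : (S.kripke ia ib).IsLinearConstant :=
    ⟨fun w v => le_total (α := WithBot Val) w v, fun _ _ => Set.mem_univ _⟩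
  have h1 := valid_of_mem_QLCcd hmem hM (⊥ : WithBot Val) (fun _ => d) (fun _ _ => Set.mem_univ _)
    (⊥ : WithBot Val) le_rfl ⟨?_, d, Set.mem_univ _, ?_, ?_⟩
  · exact ((forces_kripke_goalFormula S hib G _ _).1 h1).elim hG fun h => h rfl
  · refine (forces_conj _ _ _ _).2 fun φ hφ => ?_
    obtain ⟨r, hr, rfl⟩ := List.mem_map.1 hφ
    exact forces_kripke_rule S hia hib G (hR r hr) _
  · refine (forces_predsFormula _ _ _ _ _ _).2 fun p hp => ?_
    exact (mem_kripke_pred S hib _ _ _).2 (.inl (hd p hp))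
  · exact forces_kripke_chainFormula S hia hib (by norm_num) (g := Function.update (fun _ => d) 0 d) hc

end

open Turing.ToPartrec StateTransition

/-! ### Rules simulating partial recursive functions -/

/-- The attributes of a configuration `(k, v)`, consisting of a continuation `k` and a list `v`:
the continuation itself, its parent continuation, the list and the head stored in its topmost
frame, the list `v`, its head, its tail, and the successor of its head. -/
inductive CfgAttr : Type
  | cont | parent | frameList | frameHead | list | head | tail | succHead

/-- The predicates on configurations: the head is zero or non-zero, the tail is empty; the
configuration returns the list to the continuation; the shape of the topmost frame of the
continuation; the configuration is about to evaluate the code `f`. -/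
inductive CfgPred : Type
  | headZero | headPos | tailNil | ret | halt | cons₂
  | cons₁ (f : Code) | comp (f : Code) | fix (f : Code) | eval (f : Code)

open CfgAttr CfgPred

/-- The rules that do not depend on the code: the components of lists, numbers and continuations
are determined by them, and a number is returned to a frame `cons₂`. -/
def baseRules : List (Rule CfgAttr CfgPred) := [
  .eq cont cont parent parent,
  .eq cont cont frameList frameList,
  .eq cont cont frameHead frameHead,
  .eq list list head head,
  .eq list list tail tail,
  .eq succHead succHead head head,
  .pred head head [headZero] headZero,
  .pred succHead head [] headPos,
  .pred list list [tailNil] tailNil,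
  .pred tail list [tailNil] headZero,
  .pred tail list [tailNil] tailNil,
  .pred cont cont [halt] halt,
  .pred cont cont [cons₂] cons₂,
  .step [ret, cons₂] [ret] [(cont, parent), (tail, list), (head, frameHead)]]

/-- The rules for returning to a frame `cons₁ f`. -/
def consRules (f : Code) : List (Rule CfgAttr CfgPred) := [
  .pred cont cont [cons₁ f] (cons₁ f),
  .step [ret, cons₁ f] [eval f, cons₂] [(list, frameList), (frameHead, head), (parent, parent)]]

/-- The rules for returning to a frame `comp f`. -/
def compRules (f : Code) : List (Rule CfgAttr CfgPred) := [
  .pred cont cont [comp f] (comp f),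
  .step [ret, comp f] [eval f] [(cont, parent), (list, list)]]

/-- The rules for returning to a frame `fix f`. -/
def fixRules (f : Code) : List (Rule CfgAttr CfgPred) := [
  .pred cont cont [fix f] (fix f),
  .step [ret, fix f, headZero] [ret] [(cont, parent), (list, tail)],
  .step [ret, fix f, headPos] [eval f] [(cont, cont), (list, tail)]]

/-- The rules for evaluating a code. -/
def codeRules : Code → List (Rule CfgAttr CfgPred)
  | .zero' => [.step [eval .zero'] [ret, headZero] [(cont, cont), (tail, list)]]
  | .succ => [.step [eval .succ] [ret, tailNil] [(cont, cont), (head, succHead)]]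
  | .tail => [.step [eval .tail] [ret] [(cont, cont), (list, tail)]]
  | .cons f fs => .step [eval (.cons f fs)] [eval f, cons₁ fs]
      [(list, list), (frameList, list), (parent, cont)] ::
      (consRules fs ++ codeRules f ++ codeRules fs)
  | .comp f g => .step [eval (.comp f g)] [eval g, comp f] [(list, list), (parent, cont)] ::
      (compRules f ++ codeRules f ++ codeRules g)
  | .case f g =>
      .step [eval (.case f g), headZero] [eval f] [(cont, cont), (list, tail)] ::
      .step [eval (.case f g), headPos] [eval g] [(cont, cont), (tail, tail), (succHead, head)] ::
      (codeRules f ++ codeRules g)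
  | .fix f => .step [eval (.fix f)] [eval f, fix f] [(list, list), (parent, cont)] ::
      (fixRules f ++ codeRules f)

section soundness
variable {D Val : Type} (S : AttrModel CfgAttr CfgPred D Val)

/-- The value `u` represents the number `n`: some elements witness that it is the `n`-th successor
of the head of an element satisfying `headZero`. -/
def RepNat : Val → ℕ → Prop
  | u, 0 => ∃ x, S.pred headZero x ∧ S.attr head x = u
  | u, n + 1 => ∃ x, RepNat (S.attr head x) n ∧ S.attr succHead x = u

/-- The value `u` represents the list `l`. As for `List.headI`, the empty list has head zero and
an empty tail. -/
def RepList : Val → List ℕ → Prop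
  | u, [] => ∀ y, S.attr list y = u → S.pred headZero y ∧ S.pred tailNil y
  | u, n :: l => ∀ y, S.attr list y = u → RepNat S (S.attr head y) n ∧ RepList (S.attr tail y) l

/-- The value `u` represents the continuation `k`, and the rules for the codes in `k` hold. -/
def RepCont : Val → Cont → Prop
  | u, .halt => ∀ y, S.attr cont y = u → S.pred halt y
  | u, .cons₁ f l k => (∀ r ∈ consRules f ++ codeRules f, r.Holds S) ∧
      ∀ y, S.attr cont y = u → S.pred (cons₁ f) y ∧ RepList S (S.attr frameList y) l ∧
        RepCont (S.attr parent y) k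
  | u, .cons₂ l k => ∀ y, S.attr cont y = u → S.pred cons₂ y ∧
      RepNat S (S.attr frameHead y) l.headI ∧ RepCont (S.attr parent y) k
  | u, .comp f k => (∀ r ∈ compRules f ++ codeRules f, r.Holds S) ∧
      ∀ y, S.attr cont y = u → S.pred (comp f) y ∧ RepCont (S.attr parent y) k
  | u, .fix f k => (∀ r ∈ fixRules f ++ codeRules f, r.Holds S) ∧
      ∀ y, S.attr cont y = u → S.pred (fix f) y ∧ RepCont (S.attr parent y) k

/-- Some element represents the configuration `(k, v)` and satisfies `p`. -/
def RepCfg (p : CfgPred) (k : Cont) (v : List ℕ) : Prop :=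
  ∃ x, S.pred p x ∧ RepCont S (S.attr cont x) k ∧ RepList S (S.attr list x) v

variable {S}

theorem repNat_of_chain {n : ℕ} {x : D} (h : S.Chain succHead head headZero n x) :
    RepNat S (S.attr head x) n := by
  induction n generalizing x with
  | zero => exact ⟨x, h, rfl⟩
  | succ n ih =>
    obtain ⟨y, h1, h2⟩ := h
    exact ⟨y, ih h2, h1⟩

variable (hS : ∀ r ∈ baseRules, r.Holds S)
include hS

theorem repNat_succ_head {x : D} {n : ℕ} (h : RepNat S (S.attr head x) (n + 1)) :
    S.pred headPos x ∧ ∀ y, S.attr succHead y = S.attr head x → RepNat S (S.attr head y) n := by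
  obtain ⟨z, h1, h2⟩ := h
  have r1 := hS (.pred succHead head [] headPos) (by simp [baseRules])
  have r2 := hS (.eq succHead succHead head head) (by simp [baseRules])
  exact ⟨r1 z x h2 (by simp), fun y hy => r2 y z (hy.trans h2.symm) ▸ h1⟩

theorem repNat_zero_head {x : D} (h : RepNat S (S.attr head x) 0) : S.pred headZero x := by
  obtain ⟨z, h1, h2⟩ := h
  exact hS (.pred head head [headZero] headZero) (by simp [baseRules]) z x h2 (by simpa using h1)

theorem repList_headI_tail {x : D} {l : List ℕ} (h : RepList S (S.attr list x) l) :
    RepNat S (S.attr head x) l.headI ∧ RepList S (S.attr tail x) l.tail := by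
  cases l with
  | nil =>
    obtain ⟨h1, h2⟩ := h x rfl
    have r1 := hS (.pred tail list [tailNil] headZero) (by simp [baseRules])
    have r2 := hS (.pred tail list [tailNil] tailNil) (by simp [baseRules])
    exact ⟨⟨x, h1, rfl⟩, fun y hy => ⟨r1 x y hy.symm (by simpa using h2),
      r2 x y hy.symm (by simpa using h2)⟩⟩
  | cons n l => exact h x rfl

theorem repList_tail_of_tailNil {x : D} (h : S.pred tailNil x) :
    RepList S (S.attr tail x) [] := by
  have r1 := hS (.pred tail list [tailNil] headZero) (by simp [baseRules])
  have r2 := hS (.pred tail list [tailNil] tailNil) (by simp [baseRules])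
  exact fun y hy => ⟨r1 x y hy.symm (by simpa using h), r2 x y hy.symm (by simpa using h)⟩

theorem repList_cons {x : D} {n : ℕ} {l : List ℕ} (h1 : RepNat S (S.attr head x) n)
    (h2 : RepList S (S.attr tail x) l) : RepList S (S.attr list x) (n :: l) := by
  intro y hy
  rw [hS (.eq list list head head) (by simp [baseRules]) y x hy,
    hS (.eq list list tail tail) (by simp [baseRules]) y x hy]
  exact ⟨h1, h2⟩

/-- The rules take a represented configuration that evaluates `f` through all the transitions made
by `stepNormal`, which unfolds `f` until a list is returned to a continuation. -/
theorem repCfg_stepNormal (f : Code) (hf : ∀ r ∈ codeRules f, r.Holds S) {k : Cont} {v : List ℕ}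
    (h : RepCfg S (eval f) k v) :
    ∃ k' v', stepNormal f k v = .ret k' v' ∧ RepCfg S ret k' v' := by
  have hpar := hS (.eq cont cont parent parent) (by simp [baseRules])
  have hfl := hS (.eq cont cont frameList frameList) (by simp [baseRules])
  induction f generalizing k v with
  | zero' =>
    obtain ⟨x, h1, h2, h3⟩ := h
    obtain ⟨y, h4, h5⟩ := hf (.step _ _ _) (List.mem_singleton_self _) x (by simpa using h1)
    simp only [List.mem_cons, List.not_mem_nil, or_false, forall_eq_or_imp, forall_eq] at h4 h5
    exact ⟨k, 0 :: v, rfl, y, h4.1, h5.1 ▸ h2, repList_cons hS ⟨y, h4.2, rfl⟩ (h5.2 ▸ h3)⟩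
  | succ =>
    obtain ⟨x, h1, h2, h3⟩ := h
    obtain ⟨y, h4, h5⟩ := hf (.step _ _ _) (List.mem_singleton_self _) x (by simpa using h1)
    simp only [List.mem_cons, List.not_mem_nil, or_false, forall_eq_or_imp, forall_eq] at h4 h5
    exact ⟨k, [v.headI.succ], rfl, y, h4.1, h5.1 ▸ h2, repList_cons hS
      ⟨x, (repList_headI_tail hS h3).1, h5.2.symm⟩ (repList_tail_of_tailNil hS h4.2)⟩
  | tail =>
    obtain ⟨x, h1, h2, h3⟩ := h
    obtain ⟨y, h4, h5⟩ := hf (.step _ _ _) (List.mem_singleton_self _) x (by simpa using h1)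
    simp only [List.mem_cons, List.not_mem_nil, or_false, forall_eq_or_imp, forall_eq] at h4 h5
    exact ⟨k, v.tail, rfl, y, h4, h5.1 ▸ h2, h5.2 ▸ (repList_headI_tail hS h3).2⟩
  | cons f fs ihf _ =>
    obtain ⟨x, h1, h2, h3⟩ := h
    obtain ⟨y, h4, h5⟩ := hf (.step _ _ _) List.mem_cons_self x (by simpa using h1)
    simp only [List.mem_cons, List.not_mem_nil, or_false, forall_eq_or_imp, forall_eq] at h4 h5
    simp only [codeRules, List.mem_cons, List.mem_append, forall_eq_or_imp] at hf
    refine ihf (fun r hr => hf.2 r (by simp [hr])) ⟨y, h4.1, ⟨fun r hr => hf.2 r ?_,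
      fun z hz => ⟨?_, ?_, ?_⟩⟩, h5.1 ▸ h3⟩
    · rcases List.mem_append.1 hr with hr | hr <;> simp [hr]
    · exact hf.2 (.pred _ _ [cons₁ fs] _) (by simp [consRules]) y z hz.symm (by simpa using h4.2)
    · rw [hfl z y hz, h5.2.1]
      exact h3
    · rw [hpar z y hz, h5.2.2]
      exact h2
  | comp f g _ ihg =>
    obtain ⟨x, h1, h2, h3⟩ := h
    obtain ⟨y, h4, h5⟩ := hf (.step _ _ _) List.mem_cons_self x (by simpa using h1)
    simp only [List.mem_cons, List.not_mem_nil, or_false, forall_eq_or_imp, forall_eq] at h4 h5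
    simp only [codeRules, List.mem_cons, List.mem_append, forall_eq_or_imp] at hf
    refine ihg (fun r hr => hf.2 r (by simp [hr])) ⟨y, h4.1, ⟨fun r hr => hf.2 r ?_,
      fun z hz => ⟨?_, ?_⟩⟩, h5.1 ▸ h3⟩
    · rcases List.mem_append.1 hr with hr | hr <;> simp [hr]
    · exact hf.2 (.pred _ _ [comp f] _) (by simp [compRules]) y z hz.symm (by simpa using h4.2)
    · rw [hpar z y hz, h5.2]
      exact h2
  | case f g ihf ihg =>
    obtain ⟨x, h1, h2, h3⟩ := h
    simp only [codeRules, List.mem_cons, List.mem_append, forall_eq_or_imp] at hf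
    obtain ⟨h4, h5⟩ := repList_headI_tail hS h3
    rcases hv : v.headI with _ | n
    · rw [hv] at h4
      obtain ⟨y, h6, h7⟩ := hf.1 x (by simpa using ⟨h1, repNat_zero_head hS h4⟩)
      simp only [List.mem_cons, List.not_mem_nil, or_false, forall_eq_or_imp, forall_eq] at h6 h7
      obtain ⟨k', v', h8, h9⟩ := ihf (fun r hr => hf.2.2 r (by simp [hr]))
        ⟨y, h6, h7.1 ▸ h2, h7.2 ▸ h5⟩
      exact ⟨k', v', by rw [← h8]; simp only [stepNormal, hv]; rfl, h9⟩
    · rw [hv] at h4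
      obtain ⟨h10, h11⟩ := repNat_succ_head hS h4
      obtain ⟨y, h6, h7⟩ := hf.2.1 x (by simpa using ⟨h1, h10⟩)
      simp only [List.mem_cons, List.not_mem_nil, or_false, forall_eq_or_imp, forall_eq] at h6 h7
      obtain ⟨k', v', h8, h9⟩ := ihg (fun r hr => hf.2.2 r (by simp [hr]))
        ⟨y, h6, h7.1 ▸ h2, repList_cons hS (h11 y h7.2.2) (h7.2.1 ▸ h5)⟩
      exact ⟨k', v', by rw [← h8]; simp only [stepNormal, hv], h9⟩
  | fix f ihf =>
    obtain ⟨x, h1, h2, h3⟩ := h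
    obtain ⟨y, h4, h5⟩ := hf (.step _ _ _) List.mem_cons_self x (by simpa using h1)
    simp only [List.mem_cons, List.not_mem_nil, or_false, forall_eq_or_imp, forall_eq] at h4 h5
    simp only [codeRules, List.mem_cons, List.mem_append, forall_eq_or_imp] at hf
    refine ihf (fun r hr => hf.2 r (by simp [hr])) ⟨y, h4.1, ⟨fun r hr => hf.2 r ?_,
      fun z hz => ⟨?_, ?_⟩⟩, h5.1 ▸ h3⟩
    · rcases List.mem_append.1 hr with hr | hr <;> simp [hr]
    · exact hf.2 (.pred _ _ [fix f] _) (by simp [fixRules]) y z hz.symm (by simpa using h4.2)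
    · rw [hpar z y hz, h5.2]
      exact h2

/-- The rules follow `stepRet`, unless a final configuration is reached on the way. -/
theorem repCfg_stepRet (k : Cont) {v : List ℕ} (h : RepCfg S ret k v) :
    (∃ x, S.pred ret x ∧ S.pred halt x) ∨
      ∃ k' v', stepRet k v = .ret k' v' ∧ RepCfg S ret k' v' := by
  induction k generalizing v with
  | halt =>
    obtain ⟨x, h1, h2, -⟩ := h
    exact .inl ⟨x, h1, h2 x rfl⟩
  | cons₁ f l k _ =>
    obtain ⟨x, h1, ⟨hr, h2⟩, h3⟩ := h
    obtain ⟨h4, h5, h6⟩ := h2 x rfl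
    obtain ⟨y, h7, h8⟩ := hr (.step [ret, cons₁ f] [eval f, cons₂]
      [(list, frameList), (frameHead, head), (parent, parent)]) (by simp [consRules]) x
      (by simpa using ⟨h1, h4⟩)
    simp only [List.mem_cons, List.not_mem_nil, or_false, forall_eq_or_imp, forall_eq] at h7 h8
    have hfh := hS (.eq cont cont frameHead frameHead) (by simp [baseRules])
    have hpar := hS (.eq cont cont parent parent) (by simp [baseRules])
    refine .inr (repCfg_stepNormal hS f (fun r h => hr r (by simp [h]))
      ⟨y, h7.1, fun z hz => ⟨?_, ?_, ?_⟩, h8.1 ▸ h5⟩)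
    · exact hS (.pred cont cont [cons₂] cons₂) (by simp [baseRules]) y z hz.symm
        (by simpa using h7.2)
    · rw [hfh z y hz, h8.2.1]
      exact (repList_headI_tail hS h3).1
    · rw [hpar z y hz, h8.2.2]
      exact h6
  | cons₂ l k ih =>
    obtain ⟨x, h1, h2, h3⟩ := h
    obtain ⟨h4, h5, h6⟩ := h2 x rfl
    obtain ⟨y, h7, h8⟩ := hS (.step [ret, cons₂] [ret]
      [(cont, parent), (tail, list), (head, frameHead)]) (by simp [baseRules]) x
      (by simpa using ⟨h1, h4⟩)
    simp only [List.mem_cons, List.not_mem_nil, or_false, forall_eq_or_imp, forall_eq] at h7 h8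
    exact ih ⟨y, h7, h8.1 ▸ h6, repList_cons hS (h8.2.2 ▸ h5) (h8.2.1 ▸ h3)⟩
  | comp f k _ =>
    obtain ⟨x, h1, ⟨hr, h2⟩, h3⟩ := h
    obtain ⟨h4, h5⟩ := h2 x rfl
    obtain ⟨y, h7, h8⟩ := hr (.step [ret, comp f] [eval f] [(cont, parent), (list, list)])
      (by simp [compRules]) x (by simpa using ⟨h1, h4⟩)
    simp only [List.mem_cons, List.not_mem_nil, or_false, forall_eq_or_imp, forall_eq] at h7 h8
    exact .inr (repCfg_stepNormal hS f (fun r h => hr r (by simp [h]))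
      ⟨y, h7, h8.1 ▸ h5, h8.2 ▸ h3⟩)
  | fix f k ih =>
    obtain ⟨x, h1, ⟨hr, h2⟩, h3⟩ := h
    obtain ⟨h4, h5⟩ := h2 x rfl
    obtain ⟨h6, h7⟩ := repList_headI_tail hS h3
    rw [stepRet]
    split_ifs with hv
    · rw [hv] at h6
      obtain ⟨y, h8, h9⟩ := hr (.step [ret, fix f, headZero] [ret] [(cont, parent), (list, tail)])
        (by simp [fixRules]) x (by simpa using ⟨h1, h4, repNat_zero_head hS h6⟩)
      simp only [List.mem_cons, List.not_mem_nil, or_false, forall_eq_or_imp, forall_eq] at h8 h9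
      exact ih ⟨y, h8, h9.1 ▸ h5, h9.2 ▸ h7⟩
    · obtain ⟨n, hn⟩ := Nat.exists_eq_succ_of_ne_zero hv
      rw [hn] at h6
      obtain ⟨y, h8, h9⟩ := hr (.step [ret, fix f, headPos] [eval f] [(cont, cont), (list, tail)])
        (by simp [fixRules]) x (by simpa using ⟨h1, h4, (repNat_succ_head hS h6).1⟩)
      simp only [List.mem_cons, List.not_mem_nil, or_false, forall_eq_or_imp, forall_eq] at h8 h9
      exact .inr (repCfg_stepNormal hS f (fun r h => hr r (by simp [h]))
        ⟨y, h8, h9.1 ▸ ⟨hr, h2⟩, h9.2 ▸ h7⟩)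

/-- In a structure satisfying the rules, a represented halting computation ends in an element
that satisfies the goal. -/
theorem exists_ret_halt {k : Cont} {v : List ℕ} (h : RepCfg S ret k v)
    (hd : (StateTransition.eval step (.ret k v)).Dom) : ∃ x, S.pred ret x ∧ S.pred halt x := by
  obtain ⟨b, hb⟩ := Part.dom_iff_mem.1 hd
  have : ∀ a, b ∈ StateTransition.eval step a → ∀ k v, a = .ret k v → RepCfg S ret k v →
      ∃ x, S.pred ret x ∧ S.pred halt x := by
    intro a ha
    refine evalInduction (C := fun a => ∀ k v, a = .ret k v → RepCfg S ret k v →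
      ∃ x, S.pred ret x ∧ S.pred halt x) ha ?_
    rintro a - ih k v rfl h
    rcases repCfg_stepRet hS k h with h | ⟨k', v', h1, h2⟩
    · exact h
    · exact ih _ rfl k' v' h1 h2
  exact this _ hb k v rfl h

theorem exists_ret_halt_of_init {c : Code} (hc : ∀ r ∈ codeRules c, r.Holds S) {n : ℕ}
    (hI : ∃ x, (∀ p ∈ [eval c, halt, tailNil], S.pred p x) ∧
      S.Chain succHead head headZero n x) (hd : (c.eval [n]).Dom) :
    ∃ x, ∀ p ∈ [ret, halt], S.pred p x := by
  obtain ⟨x, h1, h2⟩ := hI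
  simp only [List.mem_cons, List.not_mem_nil, or_false, forall_eq_or_imp, forall_eq] at h1 ⊢
  have h3 : RepCfg S (eval c) .halt [n] :=
    ⟨x, h1.1, fun y hy => hS (.pred cont cont [halt] halt) (by simp [baseRules]) x y hy.symm
      (by simpa using h1.2.1), repList_cons hS (repNat_of_chain h2)
        (repList_tail_of_tailNil hS h1.2.2)⟩
  obtain ⟨k, v, h4, h5⟩ := repCfg_stepNormal hS c hc h3
  refine exists_ret_halt hS h5 ?_
  rw [← h4, stepNormal_eval]
  exact hd

end soundness

open Turing.ToPartrec StateTransition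

/-! ### The structure of non-halting configurations -/

section countermodel
open CfgAttr CfgPred

/-- The attributes of a configuration, see `CfgAttr`. An attribute that the configuration lacks
takes the value of an empty list. -/
def cfgAttr (k : Cont) (v : List ℕ) : CfgAttr → Cont ⊕ List ℕ ⊕ ℕ
  | cont => .inl k
  | parent => match k with
    | .cons₁ _ _ k => .inl k
    | .cons₂ _ k => .inl k
    | .comp _ k => .inl k
    | .fix _ k => .inl k
    | .halt => .inr (.inl [])
  | frameList => match k with
    | .cons₁ _ l _ => .inr (.inl l)
    | _ => .inr (.inl [])
  | frameHead => match k with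
    | .cons₂ l _ => .inr (.inr l.headI)
    | _ => .inr (.inl [])
  | list => .inr (.inl v)
  | head => .inr (.inr v.headI)
  | tail => .inr (.inl v.tail)
  | succHead => .inr (.inr (v.headI + 1))

/-- The predicates on configurations, see `CfgPred`. The configuration has a mode `m`, which is
`some f` if the code `f` is to be evaluated, and `none` if the list is to be returned; in both cases
the corresponding predicate requires that the computation does not halt. -/
def cfgPred (m : Option Code) (k : Cont) (v : List ℕ) : CfgPred → Prop
  | headZero => v.headI = 0
  | headPos => v.headI ≠ 0
  | tailNil => v.tail = []
  | ret => m = none ∧ ¬ (StateTransition.eval step (.ret k v)).Dom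
  | halt => k = .halt
  | cons₂ => ∃ l k', k = .cons₂ l k'
  | cons₁ f => ∃ l k', k = .cons₁ f l k'
  | comp f => ∃ k', k = .comp f k'
  | fix f => ∃ k', k = .fix f k'
  | CfgPred.eval f => m = some f ∧ ¬ (StateTransition.eval step (stepNormal f k v)).Dom

/-- The structure of all configurations in either mode. Only those whose computation does not halt
are marked as evaluating or returning. -/
def cfgModel : AttrModel CfgAttr CfgPred (Option Code × Cont × List ℕ) (Cont ⊕ List ℕ ⊕ ℕ) where
  attr a x := cfgAttr x.2.1 x.2.2 a
  pred p x := cfgPred x.1 x.2.1 x.2.2 p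

theorem eval_step_ret (k : Cont) (v : List ℕ) :
    StateTransition.eval step (.ret k v) = StateTransition.eval step (stepRet k v) :=
  reaches_eval (.single rfl)

theorem cfgModel_baseRules : ∀ r ∈ baseRules, r.Holds cfgModel := by
  simp only [baseRules, List.forall_mem_cons, List.not_mem_nil, false_imp_iff, implies_true,
    and_true]
  refine ⟨?_, ?_, ?_, ?_, ?_, ?_, ?_, ?_, ?_, ?_, ?_, ?_, ?_, ?_⟩
  -- the components of equal continuations, lists and numbers are equal
  any_goals
    rintro ⟨m, k, v⟩ ⟨m', k', v'⟩ h
    simp_all [cfgModel, cfgAttr]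
    done
  any_goals
    rintro ⟨m, k, v⟩ ⟨m', k', v'⟩ h h'
    simp_all [cfgModel, cfgAttr, cfgPred]
    done
  · rintro ⟨m, k, v⟩ ⟨m', k', v'⟩ h -
    simp only [cfgModel, cfgAttr, Sum.inr.injEq] at h
    simp [cfgModel, cfgPred, ← h]
  · rintro ⟨m, k, v⟩ h
    simp only [cfgModel, cfgPred, List.forall_mem_cons, List.not_mem_nil, false_imp_iff,
      implies_true, and_true] at h
    obtain ⟨⟨rfl, h⟩, l, k, rfl⟩ := h
    refine ⟨(none, k, l.headI :: v), ?_, by simp [cfgModel, cfgAttr]⟩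
    rw [eval_step_ret, stepRet, ← eval_step_ret] at h
    simpa [cfgModel, cfgPred] using h

theorem cfgModel_consRules (f : Code) : ∀ r ∈ consRules f, r.Holds cfgModel := by
  simp only [consRules, List.forall_mem_cons, List.not_mem_nil, false_imp_iff, implies_true,
    and_true]
  refine ⟨?_, ?_⟩
  · rintro ⟨m, k, v⟩ ⟨m', k', v'⟩ h h'
    simp_all [cfgModel, cfgAttr, cfgPred]
  · rintro ⟨m, k, v⟩ h
    simp only [cfgModel, cfgPred, List.forall_mem_cons, List.not_mem_nil, false_imp_iff,
      implies_true, and_true] at h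
    obtain ⟨⟨rfl, h⟩, l, k, rfl⟩ := h
    refine ⟨(some f, .cons₂ v k, l), ?_, by simp [cfgModel, cfgAttr]⟩
    rw [eval_step_ret, stepRet] at h
    simpa [cfgModel, cfgPred] using h

theorem cfgModel_compRules (f : Code) : ∀ r ∈ compRules f, r.Holds cfgModel := by
  simp only [compRules, List.forall_mem_cons, List.not_mem_nil, false_imp_iff, implies_true,
    and_true]
  refine ⟨?_, ?_⟩
  · rintro ⟨m, k, v⟩ ⟨m', k', v'⟩ h h'
    simp_all [cfgModel, cfgAttr, cfgPred]
  · rintro ⟨m, k, v⟩ h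
    simp only [cfgModel, cfgPred, List.forall_mem_cons, List.not_mem_nil, false_imp_iff,
      implies_true, and_true] at h
    obtain ⟨⟨rfl, h⟩, k, rfl⟩ := h
    refine ⟨(some f, k, v), ?_, by simp [cfgModel, cfgAttr]⟩
    rw [eval_step_ret, stepRet] at h
    simpa [cfgModel, cfgPred] using h

theorem cfgModel_fixRules (f : Code) : ∀ r ∈ fixRules f, r.Holds cfgModel := by
  simp only [fixRules, List.forall_mem_cons, List.not_mem_nil, false_imp_iff, implies_true,
    and_true]
  refine ⟨?_, ?_, ?_⟩
  · rintro ⟨m, k, v⟩ ⟨m', k', v'⟩ h h'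
    simp_all [cfgModel, cfgAttr, cfgPred]
  · rintro ⟨m, k, v⟩ h
    simp only [cfgModel, cfgPred, List.forall_mem_cons, List.not_mem_nil, false_imp_iff,
      implies_true, and_true] at h
    obtain ⟨⟨rfl, h⟩, ⟨k, rfl⟩, h0⟩ := h
    refine ⟨(none, k, v.tail), ?_, by simp [cfgModel, cfgAttr]⟩
    rw [eval_step_ret, stepRet, if_pos h0, ← eval_step_ret] at h
    simpa [cfgModel, cfgPred] using h
  · rintro ⟨m, k, v⟩ h
    simp only [cfgModel, cfgPred, List.forall_mem_cons, List.not_mem_nil, false_imp_iff,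
      implies_true, and_true] at h
    obtain ⟨⟨rfl, h⟩, ⟨k, rfl⟩, h0⟩ := h
    refine ⟨(some f, .fix f k, v.tail), ?_, by simp [cfgModel, cfgAttr]⟩
    rw [eval_step_ret, stepRet, if_neg h0] at h
    simpa [cfgModel, cfgPred] using h

theorem cfgModel_codeRules (f : Code) : ∀ r ∈ codeRules f, r.Holds cfgModel := by
  induction f with
  | zero' =>
    simp only [codeRules, List.forall_mem_cons, List.not_mem_nil, false_imp_iff, implies_true,
      and_true]
    rintro ⟨m, k, v⟩ h
    exact ⟨(none, k, 0 :: v),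
      by simpa [cfgModel, cfgPred, stepNormal] using (h _ (List.mem_singleton_self _)).2,
      by simp [cfgModel, cfgAttr]⟩
  | succ =>
    simp only [codeRules, List.forall_mem_cons, List.not_mem_nil, false_imp_iff, implies_true,
      and_true]
    rintro ⟨m, k, v⟩ h
    exact ⟨(none, k, [v.headI + 1]),
      by simpa [cfgModel, cfgPred, stepNormal] using (h _ (List.mem_singleton_self _)).2,
      by simp [cfgModel, cfgAttr]⟩
  | tail =>
    simp only [codeRules, List.forall_mem_cons, List.not_mem_nil, false_imp_iff, implies_true,
      and_true]
    rintro ⟨m, k, v⟩ h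
    exact ⟨(none, k, v.tail),
      by simpa [cfgModel, cfgPred, stepNormal] using (h _ (List.mem_singleton_self _)).2,
      by simp [cfgModel, cfgAttr]⟩
  | cons f fs ihf ihfs =>
    simp only [codeRules, List.forall_mem_cons, List.forall_mem_append]
    refine ⟨?_, ⟨cfgModel_consRules fs, ihf⟩, ihfs⟩
    rintro ⟨m, k, v⟩ h
    exact ⟨(some f, .cons₁ fs v k, v),
      by simpa [cfgModel, cfgPred, stepNormal] using (h _ (List.mem_singleton_self _)).2,
      by simp [cfgModel, cfgAttr]⟩
  | comp f g ihf ihg =>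
    simp only [codeRules, List.forall_mem_cons, List.forall_mem_append]
    refine ⟨?_, ⟨cfgModel_compRules f, ihf⟩, ihg⟩
    rintro ⟨m, k, v⟩ h
    exact ⟨(some g, .comp f k, v),
      by simpa [cfgModel, cfgPred, stepNormal] using (h _ (List.mem_singleton_self _)).2,
      by simp [cfgModel, cfgAttr]⟩
  | case f g ihf ihg =>
    simp only [codeRules, List.forall_mem_cons, List.forall_mem_append]
    refine ⟨?_, ?_, ihf, ihg⟩
    · rintro ⟨m, k, v⟩ h
      have h1 := (h (CfgPred.eval (.case f g)) (by simp)).2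
      have h2 : v.headI = 0 := h headZero (by simp)
      simp only [stepNormal, h2] at h1
      exact ⟨(some f, k, v.tail), by simpa [cfgModel, cfgPred] using h1,
        by simp [cfgModel, cfgAttr]⟩
    · rintro ⟨m, k, v⟩ h
      have h1 := (h (CfgPred.eval (.case f g)) (by simp)).2
      obtain ⟨n, h2⟩ := Nat.exists_eq_succ_of_ne_zero (show v.headI ≠ 0 from h headPos (by simp))
      simp only [stepNormal, h2] at h1
      exact ⟨(some g, k, n :: v.tail), by simpa [cfgModel, cfgPred] using h1,
        by simp [cfgModel, cfgAttr, h2]⟩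
  | fix f ihf =>
    simp only [codeRules, List.forall_mem_cons, List.forall_mem_append]
    refine ⟨?_, cfgModel_fixRules f, ihf⟩
    rintro ⟨m, k, v⟩ h
    exact ⟨(some f, .fix f k, v),
      by simpa [cfgModel, cfgPred, stepNormal] using (h _ (List.mem_singleton_self _)).2,
      by simp [cfgModel, cfgAttr]⟩

theorem not_exists_cfgModel_ret_halt : ¬ ∃ x, ∀ p ∈ [ret, halt], cfgModel.pred p x := by
  rintro ⟨⟨m, k, v⟩, h⟩
  obtain ⟨⟨-, h1⟩, h2⟩ : cfgPred m k v ret ∧ cfgPred m k v halt := by simpa [cfgModel] using h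
  obtain rfl : k = .halt := h2
  refine h1 (Part.dom_iff_mem.2 ⟨.halt v, mem_eval.2 ⟨.single rfl, rfl⟩⟩)

theorem cfgModel_chain (m : Option Code) (k : Cont) (n : ℕ) :
    cfgModel.Chain succHead head headZero n (m, k, [n]) := by
  induction n generalizing m k with
  | zero => rfl
  | succ n ih => exact ⟨(m, k, [n]), rfl, ih m k⟩

theorem exists_cfgModel_init {c : Code} {n : ℕ} (h : ¬ (c.eval [n]).Dom) :
    ∃ x, (∀ p ∈ [CfgPred.eval c, halt, tailNil], cfgModel.pred p x) ∧
      cfgModel.Chain succHead head headZero n x := by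
  refine ⟨(some c, .halt, [n]), ?_, cfgModel_chain _ _ n⟩
  simp only [List.forall_mem_cons, List.not_mem_nil, false_imp_iff, implies_true, and_true]
  refine ⟨⟨rfl, ?_⟩, rfl, rfl⟩
  rw [stepNormal_eval]
  exact h

end countermodel

/-! ### Computability of the reduction -/

/-- A numbering of the codes of partial recursive functions. -/
def codeIndex : Code → ℕ
  | .zero' => 0
  | .succ => 1
  | .tail => 2
  | .cons f g => 4 * Nat.pair (codeIndex f) (codeIndex g) + 3
  | .comp f g => 4 * Nat.pair (codeIndex f) (codeIndex g) + 4
  | .case f g => 4 * Nat.pair (codeIndex f) (codeIndex g) + 5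
  | .fix f => 4 * codeIndex f + 6

theorem codeIndex_injective : Function.Injective codeIndex := by
  have key : ∀ {a b c d k : ℕ}, 4 * Nat.pair a b + k = 4 * Nat.pair c d + k → a = c ∧ b = d := by
    intro a b c d k h
    exact Nat.pair_eq_pair.1 (by omega)
  intro f
  induction f with
  | zero' | succ | tail =>
    intro g h
    cases g <;> simp only [codeIndex] at h <;> first | rfl | omega
  | cons f₁ f₂ ih₁ ih₂ | comp f₁ f₂ ih₁ ih₂ | case f₁ f₂ ih₁ ih₂ =>
    intro g h
    cases g <;> simp only [codeIndex] at h <;> try omega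
    obtain ⟨h1, h2⟩ := key h
    rw [ih₁ h1, ih₂ h2]
  | fix f ih =>
    intro g h
    cases g <;> simp only [codeIndex] at h <;> try omega
    rw [ih (Nat.eq_of_mul_eq_mul_left (by norm_num) (Nat.add_right_cancel h))]

/-- A numbering of the attributes of configurations. -/
def cfgAttrIndex : CfgAttr → ℕ
  | .cont => 0
  | .parent => 1
  | .frameList => 2
  | .frameHead => 3
  | .list => 4
  | .head => 5
  | .tail => 6
  | .succHead => 7

theorem cfgAttrIndex_injective : Function.Injective cfgAttrIndex := by
  intro a b h
  cases a <;> cases b <;> first | rfl | cases h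

/-- A numbering of the predicates on configurations. -/
def cfgPredIndex : CfgPred → ℕ
  | .headZero => 0
  | .headPos => 1
  | .tailNil => 2
  | .ret => 3
  | .halt => 4
  | .cons₂ => 5
  | .cons₁ f => 4 * codeIndex f + 6
  | .comp f => 4 * codeIndex f + 7
  | .fix f => 4 * codeIndex f + 8
  | .eval f => 4 * codeIndex f + 9

theorem cfgPredIndex_injective : Function.Injective cfgPredIndex := by
  intro p q h
  cases p <;> cases q <;> simp only [cfgPredIndex] at h <;>
    first
    | rfl
    | omega
    | rw [codeIndex_injective (Nat.eq_of_mul_eq_mul_left (by norm_num) (Nat.add_right_cancel h))]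

theorem primrec_code_chainFormula (s h z : ℕ) :
    Primrec fun n => (chainFormula s h z n 0).code := by
  -- the codes for the two variables are computed by simultaneous recursion
  have key : Primrec fun n => ((chainFormula s h z n 0).code, (chainFormula s h z n 1).code) := by
    have hF : Primrec fun p : ℕ × ℕ =>
        ((6 * Nat.pair 1 (6 * Nat.pair (eqFormula s 1 h 0).code p.2 + 2) + 6,
          6 * Nat.pair 0 (6 * Nat.pair (eqFormula s 0 h 1).code p.1 + 2) + 6) : ℕ × ℕ) :=
      .pair (primrec_codePair (.const 1) (primrec_codePair (.const _) .snd 2) 6)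
        (primrec_codePair (.const 0) (primrec_codePair (.const _) .fst 2) 6)
    refine (Primrec.nat_rec₁ ((chainFormula s h z 0 0).code, (chainFormula s h z 0 1).code)
      (hF.comp₂ .right)).of_eq fun n => ?_
    induction n with
    | zero => rfl
    | succ n ih => simp only [ih]; rfl
  exact Primrec.fst.comp key

theorem primrec_code_reductionFormula {α β : Type} (ia : α → ℕ) (ib : β → ℕ)
    (R : List (Rule α β)) (I G : List β) (s h : α) (z : β) :
    Primrec fun n => (reductionFormula ia ib R I G s h z n).code :=
  primrec_codePair (primrec_codePair (.const _) (primrec_codePair (.const _)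
    (primrec_codePair (.const _) (primrec_code_chainFormula _ _ _) 2) 6) 2) (.const _) 4

/-- Every recursively enumerable set is the domain of a code, on singleton lists. -/
theorem exists_code_of_rePred {p : ℕ → Prop} (hp : REPred p) :
    ∃ c : Code, ∀ n, p n ↔ (c.eval [n]).Dom := by
  have h1 : Partrec fun n => (Part.assert (p n) fun _ => Part.some ()).map fun _ => 0 :=
    hp.map (Computable.const 0).to₂
  obtain ⟨c, hc⟩ := Code.exists_code (Nat.Partrec'.part_iff₁.2 h1)
  refine ⟨c, fun n => ?_⟩
  have := hc (n ::ᵥ List.Vector.nil)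
  rw [show (n ::ᵥ List.Vector.nil).1 = [n] from rfl] at this
  rw [this]
  simp [Part.assert, Part.map_Dom]

/-- The formula expressing that the computation of `c` on input `n` halts. -/
def haltFormula (c : Code) (n : ℕ) : Formula :=
  reductionFormula cfgAttrIndex cfgPredIndex (baseRules ++ codeRules c)
    [.eval c, .halt, .tailNil] [.ret, .halt] .succHead .head .headZero n

theorem haltFormula_mem_QLCcd_iff (c : Code) (n : ℕ) :
    haltFormula c n ∈ QLCcd ↔ (c.eval [n]).Dom := by
  constructor
  · intro h
    by_contra hd
    refine reductionFormula_notMem_QLCcd cfgAttrIndex_injective cfgPredIndex_injective cfgModel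
      (List.forall_mem_append.2 ⟨cfgModel_baseRules, cfgModel_codeRules c⟩)
      (exists_cfgModel_init hd) not_exists_cfgModel_ret_halt h
  · intro hd
    refine QLCcd_isSuperintuitionisticLogic.qInt_subset (reductionFormula_mem_QInt ?_)
    intro D Val S hS hI
    rw [List.forall_mem_append] at hS
    exact exists_ret_halt_of_init hS.1 hS.2 hI hd

end IntPred

theorem mainTheorem7 :
    IntPred.IsSigma01Complete
      (IntPred.Formula.code '' {φ | φ ∈ IntPred.QLCcd ∧ φ.InFragment}) := by
  refine ⟨IntPred.rePred_QLCcd, fun B hB => ?_⟩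
  obtain ⟨c, hc⟩ := IntPred.exists_code_of_rePred hB
  refine ⟨fun n => (IntPred.haltFormula c n).code,
    (IntPred.primrec_code_reductionFormula _ _ _ _ _ _ _ _).to_comp, fun n => ?_⟩
  refine (hc n).trans ?_
  rw [← IntPred.haltFormula_mem_QLCcd_iff]
  constructor
  · exact fun h => ⟨_, ⟨h, IntPred.inFragment_reductionFormula _ _ _ _ _ _ _ _ _⟩, rfl⟩
  · rintro ⟨φ, ⟨h, -⟩, hφ⟩
    rwa [← IntPred.Formula.code_injective hφ]
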